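/- Let $h>0$, let $S=\{(x,z)\in\mathbb R^2: -h<z<0\}$ and let $\mathbf x_0=(x_0,z_0)\in S$. For $-h\le a\le h$ let $\frac{\sinh(aD)}{\sinh(hD)}$, $D=-i\partial_x$, denote the Fourier multiplier on tempered distributions on $\mathbb R$ with symbol $k\mapsto \sinh(ak)/\sinh(hk)$ (equal to $a/h$ at $k=0$). For $-h\le z\le 0$ put $$\Gamma(\mathbf x,\mathbf x_0)=\frac1{4\pi}\Big\{\ln\big((x-x_0)^2+(z-z_0)^2\big)-\frac{\sinh((z+h)D)}{\sinh(hD)}\ln\big((x-x_0)^2+z_0^2\big)+\frac{\sinh(zD)}{\sinh(hD)}\ln\big((x-x_0)^2+(h+z_0)^2\big)\Big\},$$ where $\mathbf x=(x,z)$ and the multipliers act in the variable $x$. Then: 1. For every $z\in[-h,0]$ both multiplier terms are well defined: each of the resulting tempered distributions is given by a unique continuous real function of $x$. 2. $\Gamma(\cdot,\mathbf x_0)$ is the Dirichlet Green function of $S$: it is locally integrable in $S$, $\Delta\Gamma=\delta(\mathbf x-\mathbf x_0)$ in $S$ in the sense of distributions, it is continuous on $\overline S\setminus\{\mathbf x_0\}$,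 vanishes on the boundary lines $z=0$ and $z=-h$, and tends to $0$ as $|\mathbf x|\to\infty$ in $\overline S$. The correction $\frac1{4\pi}\ln\big((x-x_0)^2+(z-z_0)^2\big)-\Gamma$, that is, the function given by the two multiplier terms, is harmonic in $S$ and continuous on $\overline S$. 3. $\Gamma$ is an alternative form of the conformal-map and image representations: for $\mathbf x\in\overline S\setminus\{\mathbf x_0\}$, $$\Gamma(\mathbf x,\mathbf x_0)=\frac1{4\pi}\ln\frac{\cosh\frac{\pi}{h}(x-x_0)-\cos\frac{\pi}{h}(z-z_0)}{\cosh\frac{\pi}{h}(x-x_0)-\cos\frac{\pi}{h}(z+z_0)}=\lim_{N\to\infty}\frac1{4\pi}\ln\prod_{n=-N}^{N}\frac{(x-x_0)^2+(z-z_0-2nh)^2}{(x-x_0)^2+(z+z_0+2nh)^2}.$$ -/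

import Mathlib

open MeasureTheory Set Filter Topology
open scoped SchwartzMap ContDiff

noncomputable section

/-- The symbol `k ↦ sinh (a k) / sinh (h k)` of the operator `sinh (a D) [sinh (h D)]⁻¹`,
`D = -i ∂ₓ`, with its removable singularity at `k = 0` filled by `a / h`. -/
def sinhRatio (a h k : ℝ) : ℝ :=
  if k = 0 then a / h else Real.sinh (a * k) / Real.sinh (h * k)

/-- The tempered distribution `T` on the line is integration against the function `f`. -/
def IsRepresentedBy (T : 𝓢'(ℝ, ℂ)) (f : ℝ → ℝ) : Prop :=
  ∀ φ : 𝓢(ℝ, ℂ), Integrable (fun x : ℝ => φ x * (f x : ℂ)) ∧ T φ = ∫ x : ℝ, φ x * (f x : ℂ)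

/-- `u = m(D) f` with `D = -i ∂ₓ`: the symbol `m` acts as a Fourier multiplier on the tempered
distribution given by `f`, and the result is the continuous function `u`.
Mathlib's Fourier transform uses `exp (-2 π i x ξ)`, so that `D` has the symbol `k = 2 π ξ`. -/
structure IsMultiplierImage (m f u : ℝ → ℝ) : Prop where
  temperate : Function.HasTemperateGrowth (fun ξ : ℝ => (m (2 * Real.pi * ξ) : ℂ))
  continuous : Continuous u
  image : ∃ T : 𝓢'(ℝ, ℂ), IsRepresentedBy T f ∧
    IsRepresentedBy
      (TemperedDistribution.fourierMultiplierCLM ℂ (fun ξ : ℝ => (m (2 * Real.pi * ξ) : ℂ)) T) u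

open Classical in
/-- The function `m(D) f` (zero by convention if `m(D) f` is not a continuous function). -/
def multiplierApply (m f : ℝ → ℝ) : ℝ → ℝ :=
  if H : ∃ u : ℝ → ℝ, IsMultiplierImage m f u then H.choose else 0

/-- The Green function of the whole plane with pole `(x₀, z₀)`. -/
def freeGreen (x₀ z₀ x z : ℝ) : ℝ :=
  1 / (4 * Real.pi) * Real.log ((x - x₀) ^ 2 + (z - z₀) ^ 2)

/-- The multiplier representation of the Green function of the strip `-h < z < 0`. -/
def stripGreen (h x₀ z₀ x z : ℝ) : ℝ :=
  1 / (4 * Real.pi) *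
    (Real.log ((x - x₀) ^ 2 + (z - z₀) ^ 2)
      - multiplierApply (sinhRatio (z + h) h) (fun y : ℝ => Real.log ((y - x₀) ^ 2 + z₀ ^ 2)) x
      + multiplierApply (sinhRatio z h) (fun y : ℝ => Real.log ((y - x₀) ^ 2 + (h + z₀) ^ 2)) x)

/-- The strip `-h < z < 0`; the point `(x, z)` of the plane is the complex number `x + i z`. -/
def strip (h : ℝ) : Set ℂ := {p : ℂ | -h < p.im ∧ p.im < 0}

/-- `Γ` solves the Dirichlet problem `ΔΓ = δ(· - p₀)` in `Ω` (in the sense of distributions),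
`Γ = 0` on the boundary of `Ω`, attained continuously. -/
structure IsDirichletGreenFunction (Ω : Set ℂ) (p₀ : ℂ) (Γ : ℂ → ℝ) : Prop where
  locallyIntegrable : LocallyIntegrableOn Γ Ω
  laplacian_eq_dirac : ∀ φ : ℂ → ℝ, ContDiff ℝ ∞ φ → HasCompactSupport φ → tsupport φ ⊆ Ω →
    ∫ p : ℂ, Γ p * Laplacian.laplacian φ p = φ p₀
  continuousOn : ContinuousOn Γ (closure Ω \ {p₀})
  boundary : ∀ p ∈ frontier Ω, Γ p = 0

end

/-!
By the Frullani integral,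
`log (X ^ 2 + c ^ 2) = 2 ∫ t in (0, ∞), (exp (-t) - exp (-c t) cos (X t)) / t` for `c > 0`
(`multiplierLog_one`), the boundary data are superpositions of plane waves. An even Fourier
multiplier acts on the wave `cos (X t)` as multiplication by `m t`
(`integral_multiplier_mul_cos`), so Fubini's theorem against a Schwartz function shows that
`m(D) log (X ^ 2 + c ^ 2)` is the continuous function
`multiplierLog m c X = 2 ∫ (m 0 exp (-t) - m t exp (-c t) cos (X t)) / t`
(`isMultiplierImage_multiplierLog`). It is admissible because `sinh (a k) / sinh (h k)` extends to a
holomorphic function bounded by `1` on the strip `|Im k| < π / (2 h)`, whence Cauchy's estimates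
bound all its derivatives (`hasTemperateGrowth_sinhRatio`).

Put `s = z + z₀` and `d = z - z₀`. The two multiplier terms combine to the Frullani integral of the
first image `log (X ^ 2 + s ^ 2)` minus the integral of
`2 cos (X t) exp (-h t) (cosh (s t) - cosh (d t)) / (t sinh (h t))`
(`multiplierLog_sub_multiplierLog_eq`). Expanding `1 / sinh (h t)` as a geometric series, this
integral becomes the series of the logarithms of the remaining images (`tendsto_sum_imageTerm`),
which is the image form of the Green function. Euler's product for the sine evaluates the series
(`tendsto_sum_imageTerm_log_norm`): the correction equals `stripCorrection`, the logarithm of the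
modulus of a quotient of holomorphic functions without zeros on the closed strip. Thus it is
harmonic there, and the conformal-map form, the boundary values and the decay at infinity follow
from elementary identities.

Finally `Δ log |p - p₀| ^ 2 = 4 π δ` is obtained by letting `ε → 0` in
`Δ log (|p - p₀| ^ 2 + ε ^ 2) = 4 ε ^ 2 / (|p - p₀| ^ 2 + ε ^ 2) ^ 2`
(`integral_log_norm_sq_mul_laplacian`), and the harmonic correction does not contribute.
-/

open scoped FourierTransform

/-! ### The symbol `sinh (a k) / sinh (h k)` -/

theorem iteratedDeriv_comp_ofReal {F : ℂ → ℂ} (hF : ∀ x : ℝ, AnalyticAt ℂ F x) (n : ℕ) :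
    iteratedDeriv n (fun x : ℝ => F x) = fun x : ℝ => iteratedDeriv n F x := by
  induction n with
  | zero => simp
  | succ n ih =>
    ext x
    rw [iteratedDeriv_succ, ih, iteratedDeriv_succ]
    rw [iteratedDeriv_eq_iterate]
    exact ((hF x).iterated_deriv n).differentiableAt.hasDerivAt.comp_ofReal.deriv

/-- Cauchy's estimates on discs of radius `r / 2` centred on the real axis. -/
theorem exists_norm_iteratedDeriv_le_of_bounded_strip {F : ℂ → ℂ} {r C : ℝ} (hr : 0 < r)
    (hF : DifferentiableOn ℂ F {w | |w.im| < r}) (hC : ∀ w : ℂ, |w.im| < r → ‖F w‖ ≤ C) (n : ℕ) :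
    ∃ B : ℝ, ∀ x : ℝ, ‖iteratedDeriv n (fun x : ℝ => F x) x‖ ≤ B := by
  have hopen : IsOpen {w : ℂ | |w.im| < r} :=
    isOpen_lt (continuous_abs.comp Complex.continuous_im) continuous_const
  have han : ∀ x : ℝ, AnalyticAt ℂ F x := fun x =>
    hF.analyticAt (hopen.mem_nhds (by simpa using hr))
  refine ⟨n.factorial * C / (r / 2) ^ n, fun x => ?_⟩
  rw [iteratedDeriv_comp_ofReal han]
  have hsub : Metric.closedBall (x : ℂ) (r / 2) ⊆ {w : ℂ | |w.im| < r} := by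
    intro w hw
    have h1 := Complex.abs_im_le_norm (w - x)
    have h2 : ‖w - x‖ ≤ r / 2 := by simpa [dist_eq_norm] using hw
    simp only [Complex.sub_im, Complex.ofReal_im, sub_zero] at h1
    simp only [Set.mem_ofPred_eq]
    linarith
  refine Complex.norm_iteratedDeriv_le_of_forall_mem_sphere_norm_le n (by positivity) ?_ ?_
  · exact (hF.mono hsub).diffContOnCl_ball Subset.rfl
  · exact fun w hw => hC w (hsub (Metric.sphere_subset_closedBall hw))

/-- A function on the line that extends to a bounded holomorphic function on a strip has bounded
derivatives of all orders. -/
theorem hasTemperateGrowth_of_bounded_strip {F : ℂ → ℂ} {r C : ℝ} (hr : 0 < r)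
    (hF : DifferentiableOn ℂ F {w | |w.im| < r}) (hC : ∀ w : ℂ, |w.im| < r → ‖F w‖ ≤ C) :
    Function.HasTemperateGrowth (fun x : ℝ => F x) := by
  have hopen : IsOpen {w : ℂ | |w.im| < r} :=
    isOpen_lt (continuous_abs.comp Complex.continuous_im) continuous_const
  refine ⟨?_, fun n => ?_⟩
  · rw [contDiff_iff_contDiffAt]
    intro x
    have h1 : ContDiffAt ℝ ∞ F (x : ℂ) :=
      ((hF.analyticAt (hopen.mem_nhds (by simpa using hr))).contDiffAt).restrict_scalars ℝ
    exact h1.comp x Complex.ofRealCLM.contDiff.contDiffAt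
  · obtain ⟨B, hB⟩ := exists_norm_iteratedDeriv_le_of_bounded_strip hr hF hC n
    exact ⟨0, B, fun x => by
      rw [norm_iteratedFDeriv_eq_norm_iteratedDeriv]; simpa using hB x⟩

theorem Complex.norm_sinh_sq (w : ℂ) :
    ‖Complex.sinh w‖ ^ 2 = Real.sinh w.re ^ 2 + Real.sin w.im ^ 2 := by
  rw [← Complex.normSq_eq_norm_sq]
  conv_lhs => rw [← Complex.re_add_im w, Complex.sinh_add, Complex.sinh_mul_I, Complex.cosh_mul_I]
  rw [Complex.normSq_apply]
  simp only [← Complex.ofReal_sinh, ← Complex.ofReal_cosh, ← Complex.ofReal_sin,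
    ← Complex.ofReal_cos, Complex.add_re, Complex.add_im, Complex.mul_re, Complex.mul_im,
    Complex.ofReal_re, Complex.ofReal_im, Complex.I_re, Complex.I_im]
  nlinarith [Real.cosh_sq w.re, Real.sin_sq_add_cos_sq w.im]

/-- The holomorphic extension of `sinhRatio a h` to a strip around the real axis. Writing it as a
quotient of divided differences at `0` removes the singularity there. -/
noncomputable def sinhRatioExt (a h : ℝ) (w : ℂ) : ℂ :=
  dslope (fun w : ℂ => Complex.sinh (a * w)) 0 w / dslope (fun w : ℂ => Complex.sinh (h * w)) 0 w

theorem dslope_sinh_mul_zero (a : ℝ) : dslope (fun w : ℂ => Complex.sinh (a * w)) 0 0 = a := by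
  rw [dslope_same]
  have : HasDerivAt (fun w : ℂ => Complex.sinh (a * w)) (Complex.cosh (a * 0) * (a * 1)) 0 :=
    ((hasDerivAt_id (0 : ℂ)).const_mul (a : ℂ)).csinh
  simpa using this.deriv

theorem dslope_sinh_mul_of_ne (a : ℝ) {w : ℂ} (hw : w ≠ 0) :
    dslope (fun w : ℂ => Complex.sinh (a * w)) 0 w = Complex.sinh (a * w) / w := by
  rw [dslope_of_ne _ hw, slope_def_field]
  simp

theorem differentiable_dslope_sinh_mul (a : ℝ) :
    Differentiable ℂ (dslope (fun w : ℂ => Complex.sinh (a * w)) 0) := by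
  rw [← differentiableOn_univ, Complex.differentiableOn_dslope univ_mem, differentiableOn_univ]
  fun_prop

theorem sinhRatioExt_ofReal {a h : ℝ} (k : ℝ) :
    sinhRatioExt a h k = (sinhRatio a h k : ℂ) := by
  by_cases hk : k = 0
  · subst hk
    rw [Complex.ofReal_zero, sinhRatioExt, dslope_sinh_mul_zero, dslope_sinh_mul_zero]
    simp [sinhRatio]
  · have hk' : (k : ℂ) ≠ 0 := by exact_mod_cast hk
    rw [sinhRatioExt, dslope_sinh_mul_of_ne _ hk', dslope_sinh_mul_of_ne _ hk',
      div_div_div_cancel_right₀ hk']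
    simp [sinhRatio, hk]

theorem Complex.sinh_ne_zero_of_abs_im_lt {w : ℂ} (hw : w ≠ 0) (him : |w.im| < Real.pi) :
    Complex.sinh w ≠ 0 := by
  intro h0
  have h := Complex.norm_sinh_sq w
  rw [h0] at h
  have h1 : Real.sinh w.re = 0 := by
    nlinarith [sq_nonneg (Real.sinh w.re), sq_nonneg (Real.sin w.im), norm_zero (E := ℂ)]
  have h2 : Real.sin w.im = 0 := by
    nlinarith [sq_nonneg (Real.sinh w.re), sq_nonneg (Real.sin w.im), norm_zero (E := ℂ)]
  rw [Real.sinh_eq_zero] at h1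
  rw [Real.sin_eq_zero_iff_of_lt_of_lt (abs_lt.1 him).1 (abs_lt.1 him).2] at h2
  exact hw (Complex.ext h1 h2)

theorem dslope_sinh_mul_ne_zero {h : ℝ} (hh : 0 < h) {w : ℂ} (hw : |w.im| < Real.pi / h) :
    dslope (fun w : ℂ => Complex.sinh (h * w)) 0 w ≠ 0 := by
  by_cases hw0 : w = 0
  · subst hw0
    rw [dslope_sinh_mul_zero]
    exact_mod_cast hh.ne'
  · rw [dslope_sinh_mul_of_ne _ hw0]
    refine div_ne_zero (Complex.sinh_ne_zero_of_abs_im_lt ?_ ?_) hw0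
    · exact mul_ne_zero (by exact_mod_cast hh.ne') hw0
    · rw [Complex.im_ofReal_mul, abs_mul, abs_of_pos hh, mul_comm]
      rwa [lt_div_iff₀ hh] at hw

/-- `‖sinh (a w)‖ ≤ ‖sinh (h w)‖` on the strip, since `‖sinh w‖ ^ 2 = sinh (re w) ^ 2 + sin (im w) ^ 2`
and both terms are monotone for `|h * im w| ≤ π / 2`. -/
theorem norm_sinhRatioExt_le {a h : ℝ} (hh : 0 < h) (ha : |a| ≤ h) {w : ℂ}
    (hw : |w.im| < Real.pi / (2 * h)) : ‖sinhRatioExt a h w‖ ≤ 1 := by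
  by_cases hw0 : w = 0
  · subst hw0
    rw [sinhRatioExt, dslope_sinh_mul_zero, dslope_sinh_mul_zero, norm_div, Complex.norm_real,
      Complex.norm_real, Real.norm_eq_abs, Real.norm_eq_abs, abs_of_pos hh]
    exact div_le_one_of_le₀ ha hh.le
  · rw [sinhRatioExt, dslope_sinh_mul_of_ne _ hw0, dslope_sinh_mul_of_ne _ hw0,
      div_div_div_cancel_right₀ hw0, norm_div]
    refine div_le_one_of_le₀ ?_ (norm_nonneg _)
    refine (sq_le_sq₀ (norm_nonneg _) (norm_nonneg _)).1 ?_
    rw [Complex.norm_sinh_sq, Complex.norm_sinh_sq, Complex.re_ofReal_mul, Complex.re_ofReal_mul,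
      Complex.im_ofReal_mul, Complex.im_ofReal_mul]
    gcongr ?_ + ?_
    · rw [sq_le_sq, Real.abs_sinh, Real.abs_sinh, Real.sinh_le_sinh, abs_mul, abs_mul]
      exact mul_le_mul_of_nonneg_right (ha.trans (le_abs_self h)) (abs_nonneg _)
    · have e1 : |h * w.im| ≤ Real.pi / 2 := by
        rw [abs_mul, abs_of_pos hh]
        rw [lt_div_iff₀ (by positivity)] at hw
        linarith
      have e2 : |a * w.im| ≤ |h * w.im| := by
        rw [abs_mul, abs_mul, abs_of_pos hh]; gcongr
      rw [← sq_abs, ← sq_abs (Real.sin (h * w.im))]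
      have hpi := Real.pi_pos
      rw [Real.abs_sin_eq_sin_abs_of_abs_le_pi (by linarith),
        Real.abs_sin_eq_sin_abs_of_abs_le_pi (by linarith)]
      have h0 : 0 ≤ Real.sin |a * w.im| :=
        Real.sin_nonneg_of_nonneg_of_le_pi (abs_nonneg _) (by linarith)
      have := Real.sin_le_sin_of_le_of_le_pi_div_two (by linarith [abs_nonneg (a * w.im)]) e1 e2
      gcongr

theorem differentiableOn_sinhRatioExt {a h : ℝ} (hh : 0 < h) :
    DifferentiableOn ℂ (sinhRatioExt a h) {w | |w.im| < Real.pi / (2 * h)} := by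
  refine (differentiable_dslope_sinh_mul a).differentiableOn.div
    (differentiable_dslope_sinh_mul h).differentiableOn fun w hw => dslope_sinh_mul_ne_zero hh ?_
  have : Real.pi / (2 * h) ≤ Real.pi / h := by
    have := Real.pi_pos
    gcongr; linarith
  exact lt_of_lt_of_le hw this

section
variable {a h : ℝ}

theorem hasTemperateGrowth_sinhRatio (hh : 0 < h) (ha : |a| ≤ h) :
    Function.HasTemperateGrowth (fun k : ℝ => (sinhRatio a h k : ℂ)) := by
  have := hasTemperateGrowth_of_bounded_strip (r := Real.pi / (2 * h))
    (by have := Real.pi_pos; positivity) (differentiableOn_sinhRatioExt (a := a) hh)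
    (fun w hw => norm_sinhRatioExt_le hh ha hw)
  simpa only [sinhRatioExt_ofReal] using this

theorem hasTemperateGrowth_sinhRatio_two_pi (hh : 0 < h) (ha : |a| ≤ h) :
    Function.HasTemperateGrowth (fun ξ : ℝ => (sinhRatio a h (2 * Real.pi * ξ) : ℂ)) := by
  have h1 : Function.HasTemperateGrowth (fun ξ : ℝ => 2 * Real.pi * ξ) := by fun_prop
  exact (hasTemperateGrowth_sinhRatio hh ha).comp h1

theorem abs_sinhRatio_le_one (hh : 0 < h) (ha : |a| ≤ h) (k : ℝ) : |sinhRatio a h k| ≤ 1 := by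
  have := norm_sinhRatioExt_le hh ha (w := (k : ℂ))
    (by have := Real.pi_pos; simp; positivity)
  rwa [sinhRatioExt_ofReal, Complex.norm_real] at this

theorem sinhRatio_neg (k : ℝ) : sinhRatio a h (-k) = sinhRatio a h k := by
  simp [sinhRatio, Real.sinh_neg, neg_div_neg_eq]

theorem continuous_sinhRatio (hh : 0 < h) (ha : |a| ≤ h) : Continuous (sinhRatio a h) := by
  have := Complex.continuous_re.comp (hasTemperateGrowth_sinhRatio hh ha).1.continuous
  exact this

/-- The symbol is Lipschitz at `0`, which makes the integrand of `multiplierLog` bounded near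
`t = 0`. -/
theorem exists_abs_sinhRatio_sub_le (hh : 0 < h) (ha : |a| ≤ h) :
    ∃ L : ℝ, 0 ≤ L ∧ ∀ k, |sinhRatio a h k - sinhRatio a h 0| ≤ L * |k| := by
  obtain ⟨B, hB⟩ := exists_norm_iteratedDeriv_le_of_bounded_strip (r := Real.pi / (2 * h))
    (by have := Real.pi_pos; positivity) (differentiableOn_sinhRatioExt (a := a) hh)
    (fun w hw => norm_sinhRatioExt_le hh ha hw) 1
  simp only [sinhRatioExt_ofReal, iteratedDeriv_one] at hB
  refine ⟨B, (norm_nonneg _).trans (hB 0), fun k => ?_⟩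
  have := Convex.norm_image_sub_le_of_norm_deriv_le (s := univ) (x := 0) (y := k)
    (f := fun k : ℝ => (sinhRatio a h k : ℂ)) (C := B)
    (fun x _ => ((hasTemperateGrowth_sinhRatio hh ha).1.differentiable (by simp)) x)
    (fun x _ => hB x) convex_univ trivial trivial
  rwa [← Complex.ofReal_sub, Complex.norm_real, sub_zero] at this

end

/-! ### The Frullani integral of a logarithm -/

/-- The factor `t` compensates the singularity `1 / t` of the Frullani integrand. -/
theorem norm_exp_neg_sub_exp_neg_mul_le {w : ℂ} {μ t : ℝ} (h1 : μ ≤ 1) (hw : μ ≤ w.re)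
    (ht : 0 ≤ t) :
    ‖Complex.exp (-t) - Complex.exp (-(w * t))‖ ≤ ‖w - 1‖ * t * Real.exp (-(μ * t)) := by
  have hconv : Convex ℝ {v : ℂ | v.re ≤ -(μ * t)} := convex_halfSpace_re_le _
  have := Convex.norm_image_sub_le_of_norm_deriv_le (s := {v : ℂ | v.re ≤ -(μ * t)})
    (f := Complex.exp) (C := Real.exp (-(μ * t))) (x := -(w * t)) (y := -(t : ℂ))
    (fun v _ => Complex.differentiableAt_exp)
    (fun v hv => by rw [Complex.deriv_exp, Complex.norm_exp]; exact Real.exp_le_exp.2 hv) hconv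
    (by simp; exact mul_le_mul_of_nonneg_right hw ht)
    (by simp; nlinarith)
  refine this.trans (le_of_eq ?_)
  rw [show -(t : ℂ) - -(w * t) = (w - 1) * t by ring, norm_mul, Complex.norm_real,
    Real.norm_of_nonneg ht]
  ring

/-- The regularized plane wave `(m 0 * exp (-t) - m t * exp (-c t) * cos (X t)) / t`. The subtracted
term `m 0 * exp (-t)` makes it integrable at `t = 0`. -/
noncomputable def logKernel (m : ℝ → ℝ) (c X t : ℝ) : ℝ :=
  (m 0 * Real.exp (-t) - m t * (Real.exp (-(c * t)) * Real.cos (X * t))) / t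

/-- The superposition of plane waves that represents `m(D)` applied to `X ↦ log (X ^ 2 + c ^ 2)`;
for `m = 1` it is the Frullani representation of this logarithm. -/
noncomputable def multiplierLog (m : ℝ → ℝ) (c X : ℝ) : ℝ :=
  2 * ∫ t in Ioi (0 : ℝ), logKernel m c X t

theorem exp_neg_mul_mul_cos_eq_re (c X t : ℝ) :
    Real.exp (-(c * t)) * Real.cos (X * t) = (Complex.exp (-((⟨c, X⟩ : ℂ) * t))).re := by
  rw [Complex.exp_re]
  simp

theorem abs_exp_neg_sub_exp_neg_mul_cos_le {c X t : ℝ} (ht : 0 ≤ t) :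
    |Real.exp (-t) - Real.exp (-(c * t)) * Real.cos (X * t)| ≤
      (|c - 1| + |X|) * t * Real.exp (-(min 1 c * t)) := by
  have h := norm_exp_neg_sub_exp_neg_mul_le (w := ⟨c, X⟩) (μ := min 1 c) (min_le_left _ _)
    (min_le_right _ _) ht
  have h2 := Complex.abs_re_le_norm (Complex.exp (-t) - Complex.exp (-((⟨c, X⟩ : ℂ) * t)))
  rw [Complex.sub_re, ← exp_neg_mul_mul_cos_eq_re, ← Complex.ofReal_neg, Complex.exp_ofReal_re]
    at h2
  rw [← Complex.ofReal_neg] at h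
  refine h2.trans (h.trans ?_)
  have h3 := Complex.norm_le_abs_re_add_abs_im ((⟨c, X⟩ : ℂ) - 1)
  simp only [Complex.sub_re, Complex.sub_im, Complex.one_re, Complex.one_im, sub_zero] at h3
  gcongr

theorem logKernel_one (c X t : ℝ) : logKernel (fun _ => 1) c X t =
    (Real.exp (-t) - Real.exp (-(c * t)) * Real.cos (X * t)) / t := by
  simp [logKernel]

section
variable {m : ℝ → ℝ} {L c : ℝ}

theorem abs_logKernel_le (hb : ∀ k, |m k| ≤ 1) (hL : ∀ k, |m k - m 0| ≤ L * |k|) (X : ℝ) {t : ℝ}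
    (ht : 0 < t) :
    |logKernel m c X t| ≤ (|c - 1| + |X| + L) * Real.exp (-(min 1 c * t)) := by
  rw [logKernel, abs_div, abs_of_pos ht, div_le_iff₀ ht]
  have e : m 0 * Real.exp (-t) - m t * (Real.exp (-(c * t)) * Real.cos (X * t)) =
      m 0 * (Real.exp (-t) - Real.exp (-(c * t)) * Real.cos (X * t)) -
        (m t - m 0) * (Real.exp (-(c * t)) * Real.cos (X * t)) := by ring
  rw [e]
  have h1 := abs_exp_neg_sub_exp_neg_mul_cos_le (c := c) (X := X) ht.le
  have h2 : |Real.exp (-(c * t)) * Real.cos (X * t)| ≤ Real.exp (-(min 1 c * t)) := by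
    rw [abs_mul, Real.abs_exp]
    have : Real.exp (-(c * t)) ≤ Real.exp (-(min 1 c * t)) := by
      gcongr; exact min_le_right _ _
    nlinarith [Real.abs_cos_le_one (X * t), abs_nonneg (Real.cos (X * t)),
      Real.exp_pos (-(c * t))]
  have h3 := hL t
  rw [abs_of_pos ht] at h3
  calc _ ≤ |m 0| * |Real.exp (-t) - Real.exp (-(c * t)) * Real.cos (X * t)| +
        |m t - m 0| * |Real.exp (-(c * t)) * Real.cos (X * t)| := by
        rw [← abs_mul, ← abs_mul]; exact abs_sub _ _
    _ ≤ 1 * ((|c - 1| + |X|) * t * Real.exp (-(min 1 c * t))) +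
        (L * t) * Real.exp (-(min 1 c * t)) := by
        gcongr
        · exact hb 0
        · exact (abs_nonneg _).trans h3
    _ = _ := by ring

theorem integrableOn_exp_neg_mul_Ioi {μ : ℝ} (hμ : 0 < μ) :
    IntegrableOn (fun t : ℝ => Real.exp (-(μ * t))) (Ioi 0) := by
  simpa only [neg_mul] using exp_neg_integrableOn_Ioi 0 hμ

theorem measurable_logKernel (hm : Continuous m) :
    Measurable (fun p : ℝ × ℝ => logKernel m c p.1 p.2) := by
  have := hm.measurable
  unfold logKernel
  fun_prop

theorem integrableOn_logKernel (hm : Continuous m) (hb : ∀ k, |m k| ≤ 1)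
    (hL : ∀ k, |m k - m 0| ≤ L * |k|) (hc : 0 < c) (X : ℝ) :
    IntegrableOn (logKernel m c X) (Ioi 0) := by
  refine Integrable.mono' ((integrableOn_exp_neg_mul_Ioi (lt_min one_pos hc)).const_mul
    (|c - 1| + |X| + L)) ?_ ?_
  · exact ((measurable_logKernel hm).comp
      (measurable_const.prodMk measurable_id)).aestronglyMeasurable
  · exact ae_restrict_of_forall_mem measurableSet_Ioi fun t ht => abs_logKernel_le hb hL X ht

theorem abs_multiplierLog_le (hb : ∀ k, |m k| ≤ 1)
    (hL : ∀ k, |m k - m 0| ≤ L * |k|) (hc : 0 < c) :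
    ∃ B : ℝ, ∀ X, |multiplierLog m c X| ≤ B * (|c - 1| + |X| + L) := by
  refine ⟨2 * ∫ t in Ioi (0 : ℝ), Real.exp (-(min 1 c * t)), fun X => ?_⟩
  have h := norm_integral_le_of_norm_le (f := logKernel m c X)
    ((integrableOn_exp_neg_mul_Ioi (lt_min one_pos hc)).const_mul
    (|c - 1| + |X| + L)) (ae_restrict_of_forall_mem measurableSet_Ioi
      fun t ht => abs_logKernel_le hb hL X ht)
  rw [integral_const_mul, Real.norm_eq_abs (∫ t in Ioi (0 : ℝ), logKernel m c X t)] at h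
  rw [multiplierLog, abs_mul, abs_two]
  linarith

theorem continuous_multiplierLog (hm : Continuous m) (hb : ∀ k, |m k| ≤ 1)
    (hL : ∀ k, |m k - m 0| ≤ L * |k|) (hc : 0 < c) : Continuous (multiplierLog m c) := by
  refine continuous_const.mul (continuous_iff_continuousAt.2 fun X₀ => ?_)
  refine continuousAt_of_dominated (bound := fun t =>
    (|c - 1| + (|X₀| + 1) + L) * Real.exp (-(min 1 c * t))) ?_ ?_ ?_ ?_
  · exact Eventually.of_forall fun X => (integrableOn_logKernel hm hb hL hc X).aestronglyMeasurable
  · filter_upwards [Metric.ball_mem_nhds X₀ one_pos] with X hX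
    refine ae_restrict_of_forall_mem measurableSet_Ioi fun t ht =>
      (abs_logKernel_le hb hL X ht).trans ?_
    have : |X| ≤ |X₀| + 1 := by
      rw [Metric.mem_ball, Real.dist_eq] at hX
      linarith [abs_sub_abs_le_abs_sub X X₀]
    gcongr
  · exact (integrableOn_exp_neg_mul_Ioi (lt_min one_pos hc)).const_mul _
  · refine Eventually.of_forall fun t => ?_
    unfold logKernel
    fun_prop

end

/-- The Frullani integral for a complex frequency `w`. The integrand is the integral over the segment
from `1` to `w` of `ζ ↦ exp (-ζ t)`; exchanging the integrals leaves `∫ dζ / ζ = log w`. -/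
theorem integral_exp_neg_sub_exp_neg_mul_div {w : ℂ} (hw : 0 < w.re) :
    ∫ t in Ioi (0 : ℝ), (Complex.exp (-t) - Complex.exp (-(w * t))) / t = Complex.log w := by
  set μ := min 1 w.re with hμ
  have hμ0 : 0 < μ := lt_min one_pos hw
  have hre : ∀ τ ∈ Icc (0 : ℝ) 1, μ ≤ (1 + τ * (w - 1)).re := by
    intro τ hτ
    simp only [Complex.add_re, Complex.one_re, Complex.re_ofReal_mul, Complex.sub_re]
    nlinarith [min_le_left 1 w.re, min_le_right 1 w.re, hτ.1, hτ.2]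
  have inner : ∀ t ∈ Ioi (0 : ℝ), (Complex.exp (-t) - Complex.exp (-(w * t))) / t =
      ∫ τ in Ioc (0 : ℝ) 1, (w - 1) * Complex.exp (-((1 + τ * (w - 1)) * t)) := by
    intro t ht
    have ht0 : (t : ℂ) ≠ 0 := by exact_mod_cast (ne_of_gt ht)
    have hd : ∀ τ : ℝ, HasDerivAt (fun τ : ℝ => -Complex.exp (-((1 + τ * (w - 1)) * t)) / t)
        ((w - 1) * Complex.exp (-((1 + τ * (w - 1)) * t))) τ := by
      intro τ
      have h1 : HasDerivAt (fun τ : ℂ => -Complex.exp (-((1 + τ * (w - 1)) * t)) / t)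
          (-(Complex.exp (-((1 + τ * (w - 1)) * t)) * (-((1 * (w - 1)) * t))) / t) (τ : ℂ) :=
        (((((hasDerivAt_id (τ : ℂ)).mul_const (w - 1)).const_add 1).mul_const
          (t : ℂ)).neg.cexp.neg.div_const _)
      convert h1.comp_ofReal using 1
      field_simp
    rw [← intervalIntegral.integral_of_le zero_le_one,
      intervalIntegral.integral_eq_sub_of_hasDerivAt (fun τ _ => hd τ)
        (Continuous.intervalIntegrable (by fun_prop) _ _)]
    simp
    ring
  rw [setIntegral_congr_fun measurableSet_Ioi inner, integral_integral_swap]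
  · have h2 : ∀ τ ∈ Ioc (0 : ℝ) 1, ∫ t in Ioi (0 : ℝ),
        (w - 1) * Complex.exp (-((1 + τ * (w - 1)) * t)) = (w - 1) / (1 + τ * (w - 1)) := by
      intro τ hτ
      have h3 := hre τ ⟨hτ.1.le, hτ.2⟩
      have h4 := integral_exp_mul_complex_Ioi (a := -(1 + τ * (w - 1)))
        (by rw [Complex.neg_re]; linarith) 0
      simp only [neg_mul] at h4
      rw [integral_const_mul, h4]
      rw [neg_div_neg_eq]
      simp [div_eq_mul_inv]
    rw [setIntegral_congr_fun measurableSet_Ioc h2,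
      ← intervalIntegral.integral_of_le zero_le_one]
    have hd : ∀ τ ∈ uIcc (0 : ℝ) 1, HasDerivAt (fun τ : ℝ => Complex.log (1 + τ * (w - 1)))
        ((w - 1) / (1 + τ * (w - 1))) τ := by
      intro τ hτ
      rw [uIcc_of_le zero_le_one] at hτ
      have h1 : HasDerivAt (fun τ : ℂ => Complex.log (1 + τ * (w - 1)))
          ((1 * (w - 1)) / (1 + τ * (w - 1))) (τ : ℂ) :=
        ((((hasDerivAt_id (τ : ℂ)).mul_const (w - 1)).const_add 1).clog
          (Or.inl (lt_of_lt_of_le hμ0 (hre τ hτ))))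
      simpa using h1.comp_ofReal
    rw [intervalIntegral.integral_eq_sub_of_hasDerivAt hd]
    · simp
    · refine ContinuousOn.intervalIntegrable (continuousOn_const.div (by fun_prop) ?_)
      intro τ hτ h0
      rw [uIcc_of_le zero_le_one] at hτ
      have := hre τ hτ
      rw [h0] at this
      simp at this; linarith
  · rw [Measure.prod_restrict]
    have hg : IntegrableOn (fun p : ℝ × ℝ => Real.exp (-(μ * p.1)) * ‖w - 1‖)
        (Ioi (0 : ℝ) ×ˢ Ioc (0 : ℝ) 1) (volume.prod volume) := by
      rw [IntegrableOn, ← Measure.prod_restrict]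
      exact Integrable.mul_prod (integrableOn_exp_neg_mul_Ioi hμ0) (integrable_const _)
    refine Integrable.mono' hg (Continuous.aestronglyMeasurable (by fun_prop)) ?_
    refine ae_restrict_of_forall_mem (measurableSet_Ioi.prod measurableSet_Ioc) ?_
    rintro ⟨t, τ⟩ ⟨ht, hτ⟩
    have ht : 0 < t := ht
    have h3 := hre τ ⟨hτ.1.le, hτ.2⟩
    simp only [Function.uncurry]
    rw [norm_mul, mul_comm, Complex.norm_exp]
    gcongr
    rw [Complex.neg_re, Complex.re_mul_ofReal]
    nlinarith

/-- The Frullani representation of the logarithm, the real part of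
`integral_exp_neg_sub_exp_neg_mul_div` at `w = c + i X`. -/
theorem multiplierLog_one {c : ℝ} (hc : 0 < c) (X : ℝ) :
    multiplierLog (fun _ => 1) c X = Real.log (X ^ 2 + c ^ 2) := by
  have h := integral_exp_neg_sub_exp_neg_mul_div (w := ⟨c, X⟩) hc
  have h2 := congrArg Complex.re h
  rw [Complex.log_re] at h2
  have hint : IntegrableOn (fun t : ℝ =>
      (Complex.exp (-t) - Complex.exp (-((⟨c, X⟩ : ℂ) * t))) / t) (Ioi 0) := by
    refine Integrable.mono' ((integrableOn_exp_neg_mul_Ioi (lt_min one_pos hc)).const_mul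
      ‖(⟨c, X⟩ : ℂ) - 1‖) (Measurable.aestronglyMeasurable (by fun_prop)) ?_
    refine ae_restrict_of_forall_mem measurableSet_Ioi fun t ht => ?_
    have ht : 0 < t := ht
    rw [norm_div, Complex.norm_real, Real.norm_of_nonneg ht.le, div_le_iff₀ ht]
    exact (norm_exp_neg_sub_exp_neg_mul_le (min_le_left _ _) (min_le_right _ _) ht.le).trans
      (le_of_eq (by ring))
  have h3 := integral_re hint
  simp only [RCLike.re_to_complex] at h3
  rw [h] at h3
  rw [Complex.log_re, Complex.norm_def, Real.log_sqrt (Complex.normSq_nonneg _),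
    Complex.normSq_mk] at h3
  rw [multiplierLog]
  have h4 : ∀ t : ℝ, logKernel (fun _ => 1) c X t =
      ((Complex.exp (-t) - Complex.exp (-((⟨c, X⟩ : ℂ) * t))) / t).re := by
    intro t
    rw [logKernel_one, Complex.div_ofReal_re, Complex.sub_re, exp_neg_mul_mul_cos_eq_re,
      ← Complex.ofReal_neg, Complex.exp_ofReal_re]
  simp_rw [h4]
  rw [h3, show X ^ 2 + c ^ 2 = c * c + X * X by ring]
  ring

/-! ### Fourier multipliers acting on logarithms -/

section
variable {f : ℝ → ℝ} {A : ℝ}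

theorem integrable_schwartzMap_mul (hf : Continuous f) (hA : ∀ x, |f x| ≤ A * (1 + |x|))
    (φ : 𝓢(ℝ, ℂ)) : Integrable (fun x : ℝ => φ x * (f x : ℂ)) := by
  have h0 := φ.integrable_pow_mul volume 0
  have h1 := φ.integrable_pow_mul volume 1
  refine Integrable.mono' ((h0.add h1).const_mul A)
    (φ.continuous.mul (Complex.continuous_ofReal.comp hf)).aestronglyMeasurable
    (Eventually.of_forall fun x => ?_)
  rw [norm_mul, Complex.norm_real, Real.norm_eq_abs]
  simp only [Pi.add_apply, pow_zero, pow_one, one_mul, Real.norm_eq_abs]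
  nlinarith [mul_le_mul_of_nonneg_left (hA x) (norm_nonneg (φ x))]

/-- A continuous function of at most linear growth is a tempered distribution: divide it by
`1 + x ^ 2` to land in `L^∞`, and multiply the resulting distribution by `1 + x ^ 2`. -/
theorem exists_isRepresentedBy (hf : Continuous f) (hA : ∀ x, |f x| ≤ A * (1 + |x|)) :
    ∃ T : 𝓢'(ℝ, ℂ), IsRepresentedBy T f := by
  have hw : Function.HasTemperateGrowth (fun x : ℝ => ((1 + x ^ 2 : ℝ) : ℂ)) := by fun_prop
  have hpos : ∀ x : ℝ, 0 < 1 + x ^ 2 := fun x => by positivity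
  have hg : MemLp (fun x : ℝ => ((f x / (1 + x ^ 2) : ℝ) : ℂ)) ⊤ volume := by
    refine memLp_top_of_bound (Continuous.aestronglyMeasurable ?_) (2 * A)
      (Eventually.of_forall fun x => ?_)
    · exact Complex.continuous_ofReal.comp (hf.div (by fun_prop) fun x => (hpos x).ne')
    · rw [Complex.norm_real, Real.norm_eq_abs, abs_div, abs_of_pos (hpos x), div_le_iff₀ (hpos x)]
      have hA0 : 0 ≤ A := by simpa using (abs_nonneg _).trans (hA 0)
      have h2 : 1 + |x| ≤ 2 * (1 + x ^ 2) := by nlinarith [sq_abs x, sq_nonneg (|x| - 1)]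
      nlinarith [mul_le_mul_of_nonneg_left h2 hA0, hA x]
  have : Fact ((1 : ENNReal) ≤ ⊤) := ⟨le_top⟩
  refine ⟨TemperedDistribution.smulLeftCLM ℂ (fun x : ℝ => ((1 + x ^ 2 : ℝ) : ℂ))
    (Lp.toTemperedDistribution (hg.toLp _)), fun φ => ⟨integrable_schwartzMap_mul hf hA φ, ?_⟩⟩
  rw [TemperedDistribution.smulLeftCLM_apply_apply, Lp.toTemperedDistribution_apply]
  refine integral_congr_ae ?_
  filter_upwards [hg.coeFn_toLp] with x hx
  rw [hx, SchwartzMap.smulLeftCLM_apply_apply hw, smul_eq_mul, smul_eq_mul, mul_comm _ (φ x),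
    mul_assoc,
    ← Complex.ofReal_mul, mul_div_cancel₀ _ (hpos x).ne']

end

theorem eq_of_isRepresentedBy {T : 𝓢'(ℝ, ℂ)} {u v : ℝ → ℝ} (hu : Continuous u)
    (hv : Continuous v) (h : IsRepresentedBy T u) (h' : IsRepresentedBy T v) : u = v := by
  refine (hu.ae_eq_iff_eq volume hv).1 ?_
  refine ae_eq_of_integral_contDiff_smul_eq hu.locallyIntegrable hv.locallyIntegrable
    fun g hg hgs => ?_
  have hgc : HasCompactSupport (fun x : ℝ => (g x : ℂ)) := hgs.comp_left Complex.ofReal_zero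
  let φ : 𝓢(ℝ, ℂ) := hgc.toSchwartzMap (Complex.ofRealCLM.contDiff.comp hg)
  have h1 := (h φ).2.symm.trans (h' φ).2
  have h2 : ∀ x, φ x = (g x : ℂ) := fun x => rfl
  simp_rw [h2, ← Complex.ofReal_mul, integral_complex_ofReal] at h1
  exact_mod_cast h1

theorem IsMultiplierImage.unique {m f u v : ℝ → ℝ} (hu : IsMultiplierImage m f u)
    (hv : IsMultiplierImage m f v) : u = v := by
  obtain ⟨T, hT, hTu⟩ := hu.image
  obtain ⟨T', hT', hTv⟩ := hv.image
  have : T = T' := by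
    ext φ
    rw [(hT φ).2, (hT' φ).2]
  subst this
  exact eq_of_isRepresentedBy hu.continuous hv.continuous hTu hTv

theorem IsMultiplierImage.multiplierApply_eq {m f u : ℝ → ℝ} (hu : IsMultiplierImage m f u) :
    multiplierApply m f = u := by
  have H : ∃ u : ℝ → ℝ, IsMultiplierImage m f u := ⟨u, hu⟩
  rw [multiplierApply, dif_pos H]
  exact H.choose_spec.unique hu

section
variable {m : ℝ → ℝ} {L c : ℝ}

/-- Pairing `multiplierLog m c` with a Schwartz function involves the latter only through its
integrals against the plane waves `cos ((x - x₀) t)`. -/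
theorem integral_schwartzMap_mul_multiplierLog (hm : Continuous m) (hb : ∀ k, |m k| ≤ 1)
    (hL : ∀ k, |m k - m 0| ≤ L * |k|) (hc : 0 < c) (x₀ : ℝ) (φ : 𝓢(ℝ, ℂ)) :
    ∫ x : ℝ, φ x * (multiplierLog m c (x - x₀) : ℂ) =
      2 * ∫ t in Ioi (0 : ℝ), ((m 0 : ℂ) * Real.exp (-t) * (∫ x : ℝ, φ x) -
        Real.exp (-(c * t)) * (m t * ∫ x : ℝ, φ x * (Real.cos ((x - x₀) * t) : ℂ))) / t := by
  have hφ1 : Integrable (fun x : ℝ => ‖φ x‖ * (|c - 1| + |x - x₀| + L)) := by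
    have h0 := φ.integrable_pow_mul volume 0
    have h1 := φ.integrable_pow_mul volume 1
    have hL0 : 0 ≤ L := by simpa using (abs_nonneg _).trans (hL 1)
    refine Integrable.mono' ((h0.const_mul (|c - 1| + |x₀| + L)).add h1) ?_
      (Eventually.of_forall fun x => ?_)
    · have := φ.continuous
      exact Continuous.aestronglyMeasurable (by fun_prop)
    · rw [norm_mul, norm_norm, Real.norm_of_nonneg (by positivity)]
      simp only [Pi.add_apply, pow_zero, pow_one, one_mul, Real.norm_eq_abs]
      nlinarith [mul_le_mul_of_nonneg_left (abs_sub x x₀) (norm_nonneg (φ x))]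
  have hint : Integrable (Function.uncurry fun (x t : ℝ) =>
      φ x * (logKernel m c (x - x₀) t : ℂ)) (volume.prod (volume.restrict (Ioi 0))) := by
    refine Integrable.mono' (Integrable.mul_prod hφ1
      (integrableOn_exp_neg_mul_Ioi (lt_min one_pos hc))) ?_ ?_
    · refine (Measurable.mul (φ.continuous.measurable.comp measurable_fst)
        (Complex.measurable_ofReal.comp ((measurable_logKernel hm).comp
          (?_ : Measurable fun p : ℝ × ℝ => ((p.1 - x₀, p.2) : ℝ × ℝ))))).aestronglyMeasurable
      fun_prop
    · have : (volume : Measure ℝ).prod (volume.restrict (Ioi (0 : ℝ))) =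
          (volume.prod volume).restrict (univ ×ˢ Ioi 0) := by
        rw [← Measure.prod_restrict, Measure.restrict_univ]
      rw [this]
      refine ae_restrict_of_forall_mem (MeasurableSet.univ.prod measurableSet_Ioi) ?_
      rintro ⟨x, t⟩ ⟨-, ht⟩
      simp only [Function.uncurry]
      rw [norm_mul, Complex.norm_real, mul_assoc]
      exact mul_le_mul_of_nonneg_left (abs_logKernel_le hb hL _ ht) (norm_nonneg _)
  have e1 : ∀ x : ℝ, φ x * (multiplierLog m c (x - x₀) : ℂ) =
      2 * ∫ t in Ioi (0 : ℝ), φ x * (logKernel m c (x - x₀) t : ℂ) := by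
    intro x
    rw [integral_const_mul, integral_complex_ofReal, multiplierLog]
    push_cast
    ring
  simp_rw [e1]
  rw [integral_const_mul, integral_integral_swap hint]
  congr 1
  refine integral_congr_ae (Eventually.of_forall fun t => ?_)
  have hi1 : Integrable (fun x : ℝ => φ x * (Real.cos ((x - x₀) * t) : ℂ)) := by
    refine Integrable.mono φ.integrable ?_ (Eventually.of_forall fun x => ?_)
    · have := φ.continuous
      exact Continuous.aestronglyMeasurable (by fun_prop)
    · rw [norm_mul, Complex.norm_real]
      exact mul_le_of_le_one_right (norm_nonneg _) (Real.abs_cos_le_one _)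
  have e2 : ∀ x : ℝ, φ x * (logKernel m c (x - x₀) t : ℂ) =
      ((m 0 : ℂ) * Real.exp (-t) / t) * φ x -
        (m t * Real.exp (-(c * t)) / t) * (φ x * (Real.cos ((x - x₀) * t) : ℂ)) := by
    intro x
    rw [logKernel]
    push_cast
    ring
  simp only
  simp_rw [e2]
  rw [integral_sub (φ.integrable.const_mul _) (hi1.const_mul _), integral_const_mul,
    integral_const_mul]
  ring

/-- The transpose of an even Fourier multiplier `m(D)` multiplies the integral of a Schwartz function
against `cos ((x - x₀) t)` by `m t`. -/
theorem integral_multiplier_mul_cos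
    (hm : Function.HasTemperateGrowth (fun ξ : ℝ => (m (2 * Real.pi * ξ) : ℂ)))
    (heven : ∀ k, m (-k) = m k) (x₀ t : ℝ) (φ : 𝓢(ℝ, ℂ)) :
    ∫ x : ℝ, (𝓕 (SchwartzMap.smulLeftCLM ℂ (fun ξ : ℝ => (m (2 * Real.pi * ξ) : ℂ)) (𝓕⁻ φ))) x *
        (Real.cos ((x - x₀) * t) : ℂ) =
      m t * ∫ x : ℝ, φ x * (Real.cos ((x - x₀) * t) : ℂ) := by
  set Φ : 𝓢(ℝ, ℂ) :=
    𝓕 (SchwartzMap.smulLeftCLM ℂ (fun ξ : ℝ => (m (2 * Real.pi * ξ) : ℂ)) (𝓕⁻ φ)) with hΦ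
  have hinv : ∀ ψ : 𝓢(ℝ, ℂ), ∀ s : ℝ, (𝓕⁻ ψ : 𝓢(ℝ, ℂ)) (s / (2 * Real.pi)) =
      ∫ x : ℝ, Complex.exp (x * s * Complex.I) * ψ x := by
    intro ψ s
    rw [SchwartzMap.fourierInv_coe, Real.fourierInv_eq']
    refine integral_congr_ae (Eventually.of_forall fun x => ?_)
    have hpi := Real.pi_ne_zero
    simp only [smul_eq_mul]
    congr 2
    simp
    field_simp
  have key : ∀ s : ℝ, ∫ x : ℝ, Complex.exp (x * s * Complex.I) * Φ x =
      m s * ∫ x : ℝ, Complex.exp (x * s * Complex.I) * φ x := by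
    intro s
    rw [← hinv, ← hinv, hΦ, FourierTransform.fourierInv_fourier_eq,
      SchwartzMap.smulLeftCLM_apply_apply hm, smul_eq_mul,
      mul_div_cancel₀ _ (by have := Real.pi_ne_zero; positivity)]
  have hcos : ∀ ψ : 𝓢(ℝ, ℂ), ∫ x : ℝ, ψ x * (Real.cos ((x - x₀) * t) : ℂ) =
      Complex.exp (-(x₀ * t * Complex.I)) / 2 * (∫ x : ℝ, Complex.exp (x * t * Complex.I) * ψ x) +
      Complex.exp (x₀ * t * Complex.I) / 2 *
        ∫ x : ℝ, Complex.exp (x * (-t : ℝ) * Complex.I) * ψ x := by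
    intro ψ
    have hi : ∀ s : ℝ, Integrable (fun x : ℝ => Complex.exp (x * s * Complex.I) * ψ x) := by
      intro s
      refine Integrable.mono ψ.integrable ?_ (Eventually.of_forall fun x => ?_)
      · have := ψ.continuous
        exact Continuous.aestronglyMeasurable (by fun_prop)
      · rw [norm_mul, ← Complex.ofReal_mul, Complex.norm_exp_ofReal_mul_I, one_mul]
    rw [← integral_const_mul, ← integral_const_mul,
      ← integral_add ((hi t).const_mul _) ((hi (-t)).const_mul _)]
    refine integral_congr_ae (Eventually.of_forall fun x => ?_)
    simp only
    rw [Complex.ofReal_cos, Complex.cos]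
    push_cast
    rw [show ((x : ℂ) - x₀) * t * Complex.I = -(x₀ * t * Complex.I) + x * t * Complex.I by ring,
      show -(((x : ℂ) - x₀) * t) * Complex.I = x₀ * t * Complex.I + x * -t * Complex.I by ring,
      Complex.exp_add, Complex.exp_add]
    ring
  rw [hcos, hcos, key, key, heven]
  ring

/-- Both sides of the defining identity of the multiplier are evaluated with
`integral_schwartzMap_mul_multiplierLog`, on the left for the symbol `1`, on the right for `m`; they
agree by `integral_multiplier_mul_cos`. -/
theorem isMultiplierImage_multiplierLog
    (hm : Function.HasTemperateGrowth (fun ξ : ℝ => (m (2 * Real.pi * ξ) : ℂ)))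
    (heven : ∀ k, m (-k) = m k) (hmc : Continuous m) (hb : ∀ k, |m k| ≤ 1)
    (hL : ∀ k, |m k - m 0| ≤ L * |k|) (hc : 0 < c) (x₀ : ℝ) :
    IsMultiplierImage m (fun y => Real.log ((y - x₀) ^ 2 + c ^ 2))
      (fun x => multiplierLog m c (x - x₀)) := by
  have h1b : ∀ k : ℝ, |(fun _ : ℝ => (1 : ℝ)) k| ≤ 1 := by simp
  have h1L : ∀ k : ℝ, |(fun _ : ℝ => (1 : ℝ)) k - (fun _ : ℝ => (1 : ℝ)) 0| ≤ 0 * |k| := by simp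
  have hgrowth : ∀ {n : ℝ → ℝ} {K : ℝ}, (∀ k, |n k| ≤ 1) → (∀ k, |n k - n 0| ≤ K * |k|) →
      ∃ A : ℝ, ∀ x, |multiplierLog n c (x - x₀)| ≤ A * (1 + |x|) := by
    intro n K hn hK
    obtain ⟨B, hB⟩ := abs_multiplierLog_le hn hK hc
    have hK0 : 0 ≤ K := by simpa using (abs_nonneg _).trans (hK 1)
    refine ⟨|B| * (|c - 1| + 1 + |x₀| + K), fun x => (hB _).trans ?_⟩
    rw [mul_assoc]
    refine mul_le_mul (le_abs_self B) ?_ (by positivity) (abs_nonneg _)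
    nlinarith [abs_sub x x₀, abs_nonneg (c - 1), abs_nonneg x, abs_nonneg x₀,
      mul_nonneg (abs_nonneg (c - 1)) (abs_nonneg x), mul_nonneg (abs_nonneg x₀) (abs_nonneg x),
      mul_nonneg hK0 (abs_nonneg x)]
  have hf : (fun y => Real.log ((y - x₀) ^ 2 + c ^ 2)) =
      fun x => multiplierLog (fun _ => 1) c (x - x₀) := by
    ext x
    rw [multiplierLog_one hc]
  have hcont : ∀ {n : ℝ → ℝ} {K : ℝ}, Continuous n → (∀ k, |n k| ≤ 1) →
      (∀ k, |n k - n 0| ≤ K * |k|) → Continuous (fun x => multiplierLog n c (x - x₀)) :=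
    fun hn1 hn2 hn3 => (continuous_multiplierLog hn1 hn2 hn3 hc).comp
      (continuous_id.sub continuous_const)
  rw [hf]
  refine ⟨hm, hcont hmc hb hL, ?_⟩
  obtain ⟨A, hA⟩ := hgrowth h1b h1L
  obtain ⟨A', hA'⟩ := hgrowth hb hL
  obtain ⟨T, hT⟩ := exists_isRepresentedBy (hcont continuous_const h1b h1L) hA
  refine ⟨T, hT, fun φ => ⟨integrable_schwartzMap_mul (hcont hmc hb hL) hA' φ, ?_⟩⟩
  rw [TemperedDistribution.fourierMultiplierCLM_apply_apply, (hT _).2,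
    integral_schwartzMap_mul_multiplierLog continuous_const h1b h1L hc,
    integral_schwartzMap_mul_multiplierLog hmc hb hL hc]
  have h0 := integral_multiplier_mul_cos hm heven x₀ 0 φ
  simp only [mul_zero, Real.cos_zero, Complex.ofReal_one, mul_one] at h0
  simp_rw [integral_multiplier_mul_cos hm heven x₀ _ φ, h0]
  congr 1
  refine integral_congr_ae (Eventually.of_forall fun t => ?_)
  push_cast
  ring

end

/-! ### The image series and Euler's product -/

/-- The density of the plane waves `cos (X t)` in all images except the first one, where `s = z + z₀`
and `d = z - z₀`. -/
noncomputable def imageKernel (h s d t : ℝ) : ℝ :=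
  Real.exp (-(h * t)) * (Real.cosh (s * t) - Real.cosh (d * t)) / (t * Real.sinh (h * t))

theorem logKernel_sinhRatio_sub_logKernel_sinhRatio {h z z₀ X t : ℝ} (hh : 0 < h) (ht : 0 < t) :
    logKernel (sinhRatio (z + h) h) (-z₀) X t - logKernel (sinhRatio z h) (h + z₀) X t =
      logKernel (fun _ => 1) (-(z + z₀)) X t -
        Real.cos (X * t) * imageKernel h (z + z₀) (z - z₀) t := by
  have hs : Real.sinh (h * t) ≠ 0 := (Real.sinh_pos_iff.2 (mul_pos hh ht)).ne'
  have hM : Real.sinh ((z + h) * t) * Real.exp (-(-z₀ * t)) -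
      Real.sinh (z * t) * Real.exp (-((h + z₀) * t)) =
      Real.sinh (h * t) * Real.exp (-(-(z + z₀) * t)) +
        Real.exp (-(h * t)) * (Real.cosh ((z + z₀) * t) - Real.cosh ((z - z₀) * t)) := by
    simp only [Real.sinh_eq, Real.cosh_eq]
    rw [show (z + h) * t = z * t + h * t by ring, show -(-z₀ * t) = z₀ * t by ring,
      show -((h + z₀) * t) = -(h * t) + -(z₀ * t) by ring,
      show -(-(z + z₀) * t) = z * t + z₀ * t by ring,
      show (z + z₀) * t = z * t + z₀ * t by ring, show (z - z₀) * t = z * t + -(z₀ * t) by ring]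
    simp only [neg_add, neg_neg, Real.exp_add]
    ring
  have hM' : sinhRatio (z + h) h t * Real.exp (-(-z₀ * t)) -
      sinhRatio z h t * Real.exp (-((h + z₀) * t)) =
      Real.exp (-(-(z + z₀) * t)) + t * imageKernel h (z + z₀) (z - z₀) t := by
    simp only [sinhRatio, ht.ne', if_false, imageKernel]
    rw [div_mul_eq_mul_div, div_mul_eq_mul_div, ← sub_div, hM, add_div,
      mul_div_cancel_left₀ _ hs, ← mul_div_assoc, mul_div_mul_left _ _ ht.ne']
  have h0 : sinhRatio (z + h) h 0 - sinhRatio z h 0 = 1 := by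
    simp only [sinhRatio, if_true]
    field_simp
    ring
  rw [logKernel_one]
  unfold logKernel
  rw [← mul_div_cancel_left₀ (Real.cos (X * t) * imageKernel h (z + z₀) (z - z₀) t) ht.ne',
    ← sub_div, ← sub_div]
  congr 1
  linear_combination Real.exp (-t) * h0 - Real.cos (X * t) * hM'

theorem logKernel_one_sub_logKernel_one (a b X t : ℝ) :
    logKernel (fun _ => 1) b X t - logKernel (fun _ => 1) a X t =
      Real.cos (X * t) * (Real.exp (-(a * t)) - Real.exp (-(b * t))) / t := by
  rw [logKernel_one, logKernel_one]
  ring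

theorem integrableOn_logKernel_one {c : ℝ} (hc : 0 < c) (X : ℝ) :
    IntegrableOn (logKernel (fun _ => 1) c X) (Ioi 0) :=
  integrableOn_logKernel (L := 0) continuous_const (by simp) (by simp) hc X

theorem two_mul_integral_logKernel_one {c : ℝ} (hc : 0 < c) (X : ℝ) :
    2 * ∫ t in Ioi (0 : ℝ), logKernel (fun _ => 1) c X t = Real.log (X ^ 2 + c ^ 2) :=
  multiplierLog_one hc X

/-- The contribution of the images at height `± 2 n h` relative to the pole (variable `d`) and to its
reflection (variable `s`). -/
noncomputable def imageTerm (h s d X : ℝ) (n : ℕ) : ℝ :=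
  Real.log (X ^ 2 + (2 * n * h - d) ^ 2) + Real.log (X ^ 2 + (2 * n * h + d) ^ 2) -
    Real.log (X ^ 2 + (2 * n * h - s) ^ 2) - Real.log (X ^ 2 + (2 * n * h + s) ^ 2)

section
variable {h s d X : ℝ}

/-- One step of the geometric expansion of `1 / sinh (h t)`: the weights `exp (-2 N h t)` and
`exp (-2 (N + 1) h t)` differ by `2 exp (-(2 N + 1) h t) sinh (h t)`, which cancels the denominator
of `imageKernel`. -/
theorem imageKernel_sub_eq_logKernel (hh : 0 < h) {t : ℝ} (ht : 0 < t) (N : ℕ) :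
    Real.exp (-(2 * N * h * t)) * (Real.cos (X * t) * imageKernel h s d t) -
      Real.exp (-(2 * (N + 1 : ℕ) * h * t)) * (Real.cos (X * t) * imageKernel h s d t) =
    (logKernel (fun _ => 1) (2 * (N + 1 : ℕ) * h - d) X t -
      logKernel (fun _ => 1) (2 * (N + 1 : ℕ) * h - s) X t) +
    (logKernel (fun _ => 1) (2 * (N + 1 : ℕ) * h + d) X t -
      logKernel (fun _ => 1) (2 * (N + 1 : ℕ) * h + s) X t) := by
  have hs : Real.sinh (h * t) ≠ 0 := (Real.sinh_pos_iff.2 (mul_pos hh ht)).ne'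
  rw [logKernel_one_sub_logKernel_one, logKernel_one_sub_logKernel_one, imageKernel]
  have e1 : Real.exp (-(2 * N * h * t)) * Real.exp (-(h * t)) -
      Real.exp (-(2 * (N + 1 : ℕ) * h * t)) * Real.exp (-(h * t)) =
      2 * Real.exp (-(2 * (N + 1 : ℕ) * h * t)) * Real.sinh (h * t) := by
    rw [Real.sinh_eq]
    have : Real.exp (-(2 * N * h * t)) =
        Real.exp (-(2 * (N + 1 : ℕ) * h * t)) * Real.exp (h * t) * Real.exp (h * t) := by
      rw [← Real.exp_add, ← Real.exp_add]
      push_cast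
      ring_nf
    rw [this]
    have h2 : Real.exp (h * t) * Real.exp (-(h * t)) = 1 := by rw [← Real.exp_add]; simp
    linear_combination Real.exp (-(2 * (N + 1 : ℕ) * h * t)) * Real.exp (h * t) * h2
  have e2 : Real.exp (-((2 * (N + 1 : ℕ) * h - s) * t)) -
        Real.exp (-((2 * (N + 1 : ℕ) * h - d) * t)) +
      (Real.exp (-((2 * (N + 1 : ℕ) * h + s) * t)) - Real.exp (-((2 * (N + 1 : ℕ) * h + d) * t))) =
      2 * Real.exp (-(2 * (N + 1 : ℕ) * h * t)) * (Real.cosh (s * t) - Real.cosh (d * t)) := by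
    have e3 : ∀ r : ℝ, Real.exp (-((2 * (N + 1 : ℕ) * h - r) * t)) =
        Real.exp (-(2 * (N + 1 : ℕ) * h * t)) * Real.exp (r * t) := by
      intro r; rw [← Real.exp_add]; ring_nf
    have e4 : ∀ r : ℝ, Real.exp (-((2 * (N + 1 : ℕ) * h + r) * t)) =
        Real.exp (-(2 * (N + 1 : ℕ) * h * t)) * Real.exp (-(r * t)) := by
      intro r; rw [← Real.exp_add]; ring_nf
    rw [e3, e3, e4, e4, Real.cosh_eq, Real.cosh_eq]
    ring
  rw [← add_div, ← mul_add, e2, ← sub_mul]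
  clear e2
  generalize Real.exp (-(2 * N * h * t)) = a at *
  generalize Real.exp (-(2 * (N + 1 : ℕ) * h * t)) = b at *
  generalize Real.cosh (s * t) - Real.cosh (d * t) = C at *
  generalize Real.sinh (h * t) = S at *
  generalize Real.exp (-(h * t)) = E at *
  generalize Real.cos (X * t) = c at *
  field_simp
  linear_combination c * C * e1

theorem integral_imageKernel_sub (hh : 0 < h) (hs : |s| < 2 * h) (hd : |d| < 2 * h)
    (hint : IntegrableOn (fun t => Real.cos (X * t) * imageKernel h s d t) (Ioi 0)) (N : ℕ) :
    2 * (∫ t in Ioi (0 : ℝ), Real.exp (-(2 * N * h * t)) *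
      (Real.cos (X * t) * imageKernel h s d t)) -
    2 * (∫ t in Ioi (0 : ℝ), Real.exp (-(2 * (N + 1 : ℕ) * h * t)) *
      (Real.cos (X * t) * imageKernel h s d t)) = imageTerm h s d X (N + 1) := by
  have hi : ∀ n : ℕ, IntegrableOn (fun t => Real.exp (-(2 * n * h * t)) *
      (Real.cos (X * t) * imageKernel h s d t)) (Ioi 0) := by
    intro n
    refine Integrable.mono hint ?_ (ae_restrict_of_forall_mem measurableSet_Ioi fun t ht => ?_)
    · exact (Continuous.aestronglyMeasurable (by fun_prop)).mul hint.aestronglyMeasurable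
    · rw [norm_mul]
      refine mul_le_of_le_one_left (norm_nonneg _) ?_
      have ht : 0 < t := ht
      rw [Real.norm_of_nonneg (Real.exp_pos _).le, Real.exp_le_one_iff]
      have : 0 ≤ 2 * (n : ℝ) * h * t := by positivity
      linarith
  have hpos : ∀ r : ℝ, |r| < 2 * h → 0 < 2 * (N + 1 : ℕ) * h - r ∧ 0 < 2 * (N + 1 : ℕ) * h + r := by
    intro r hr
    rw [abs_lt] at hr
    have : 0 ≤ (N : ℝ) * h := by positivity
    push_cast
    constructor <;> nlinarith
  rw [← mul_sub, ← integral_sub (hi N) (hi (N + 1)),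
    setIntegral_congr_fun measurableSet_Ioi fun t ht => imageKernel_sub_eq_logKernel hh ht N]
  have k1 := integrableOn_logKernel_one (hpos d hd).1 X
  have k2 := integrableOn_logKernel_one (hpos s hs).1 X
  have k3 := integrableOn_logKernel_one (hpos d hd).2 X
  have k4 := integrableOn_logKernel_one (hpos s hs).2 X
  have hadd := integral_add (k1.sub k2) (k3.sub k4)
  simp only [Pi.sub_apply] at hadd
  rw [hadd, integral_sub k1 k2, integral_sub k3 k4, imageTerm,
    ← two_mul_integral_logKernel_one (hpos d hd).1, ← two_mul_integral_logKernel_one (hpos s hs).1,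
    ← two_mul_integral_logKernel_one (hpos d hd).2, ← two_mul_integral_logKernel_one (hpos s hs).2]
  ring

/-- The partial sums telescope by `integral_imageKernel_sub`, and the remainder tends to `0` by
dominated convergence. -/
theorem tendsto_sum_imageTerm (hh : 0 < h) (hs : |s| < 2 * h) (hd : |d| < 2 * h)
    (hint : IntegrableOn (fun t => Real.cos (X * t) * imageKernel h s d t) (Ioi 0)) :
    Tendsto (fun N : ℕ => ∑ n ∈ Finset.range N, imageTerm h s d X (n + 1)) atTop
      (𝓝 (2 * ∫ t in Ioi (0 : ℝ), Real.cos (X * t) * imageKernel h s d t)) := by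
  set I : ℕ → ℝ := fun N => 2 * ∫ t in Ioi (0 : ℝ), Real.exp (-(2 * N * h * t)) *
      (Real.cos (X * t) * imageKernel h s d t) with hI
  have hsum : ∀ N, ∑ n ∈ Finset.range N, imageTerm h s d X (n + 1) = I 0 - I N := by
    intro N
    rw [← Finset.sum_range_sub']
    exact Finset.sum_congr rfl fun n _ => (integral_imageKernel_sub hh hs hd hint n).symm
  have h0 : I 0 = 2 * ∫ t in Ioi (0 : ℝ), Real.cos (X * t) * imageKernel h s d t := by
    simp [hI]
  have hlim : Tendsto I atTop (𝓝 (2 * ∫ t in Ioi (0 : ℝ), (0 : ℝ))) := by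
    refine Tendsto.const_mul _ (tendsto_integral_of_dominated_convergence
      (fun t => ‖Real.cos (X * t) * imageKernel h s d t‖) ?_ hint.norm ?_ ?_)
    · exact fun n => (Continuous.aestronglyMeasurable (by fun_prop)).mul hint.aestronglyMeasurable
    · refine fun n => ae_restrict_of_forall_mem measurableSet_Ioi fun t ht => ?_
      have ht : 0 < t := ht
      rw [norm_mul]
      refine mul_le_of_le_one_left (norm_nonneg _) ?_
      rw [Real.norm_of_nonneg (Real.exp_pos _).le, Real.exp_le_one_iff]
      have : 0 ≤ 2 * (n : ℝ) * h * t := by positivity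
      linarith
    · refine ae_restrict_of_forall_mem measurableSet_Ioi fun t ht => ?_
      have ht : 0 < t := ht
      rw [← zero_mul (Real.cos (X * t) * imageKernel h s d t)]
      refine Tendsto.mul_const _ (Real.tendsto_exp_neg_atTop_nhds_zero.comp ?_)
      have := (tendsto_natCast_atTop_atTop (R := ℝ)).atTop_mul_const
        (show 0 < 2 * h * t by positivity)
      refine this.congr fun n => ?_
      ring
  simp only [integral_zero, mul_zero] at hlim
  simp_rw [hsum]
  rw [← h0]
  simpa using hlim.const_sub (I 0)

end

/-- Euler's product for the sine at `i q / (2 h)`; the divided difference covers `q = 0`. -/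
theorem tendsto_prod_one_add_sq_div {h : ℝ} (hh : 0 < h) (q : ℂ) :
    Tendsto (fun N : ℕ => ∏ n ∈ Finset.range N, (1 + q ^ 2 / (2 * (n + 1 : ℕ) * h : ℝ) ^ 2)) atTop
      (𝓝 (dslope (fun w : ℂ => Complex.sinh ((Real.pi / (2 * h) : ℝ) * w)) 0 q /
        (Real.pi / (2 * h) : ℝ))) := by
  have hpi : (Real.pi : ℂ) ≠ 0 := by exact_mod_cast Real.pi_ne_zero
  have hh' : (h : ℂ) ≠ 0 := by exact_mod_cast hh.ne'
  have hk : 0 < Real.pi / (2 * h) := by have := Real.pi_pos; positivity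
  by_cases hq : q = 0
  · subst hq
    rw [dslope_sinh_mul_zero, div_self (by exact_mod_cast hk.ne')]
    simp
  · have h1 := Complex.tendsto_euler_sin_prod (q * Complex.I / (2 * h))
    have hne : (Real.pi : ℂ) * (q * Complex.I / (2 * h)) ≠ 0 := by
      simp [hq, hpi, hh']
    have h2 := h1.const_mul (((Real.pi : ℂ) * (q * Complex.I / (2 * h)))⁻¹)
    have hlim : ((Real.pi : ℂ) * (q * Complex.I / (2 * h)))⁻¹ *
        Complex.sin (Real.pi * (q * Complex.I / (2 * h))) =
        dslope (fun w : ℂ => Complex.sinh ((Real.pi / (2 * h) : ℝ) * w)) 0 q /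
          (Real.pi / (2 * h) : ℝ) := by
      rw [dslope_sinh_mul_of_ne _ hq, show (Real.pi : ℂ) * (q * Complex.I / (2 * h)) =
        ((Real.pi / (2 * h) : ℝ) * q) * Complex.I by push_cast; ring, Complex.sin_mul_I]
      push_cast
      field_simp
    rw [hlim] at h2
    refine h2.congr fun N => ?_
    rw [← mul_assoc, inv_mul_cancel₀ hne, one_mul]
    refine Finset.prod_congr rfl fun n _ => ?_
    have : (n : ℂ) + 1 ≠ 0 := by exact_mod_cast Nat.succ_ne_zero n
    push_cast
    field_simp
    rw [Complex.I_sq]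
    ring

theorem log_add_log_eq_log_norm_one_add {h d X : ℝ} (hh : 0 < h) (hd : |d| < 2 * h) (n : ℕ) :
    1 + (⟨X, d⟩ : ℂ) ^ 2 / (2 * (n + 1 : ℕ) * h : ℝ) ^ 2 ≠ 0 ∧
    Real.log (X ^ 2 + (2 * (n + 1 : ℕ) * h - d) ^ 2) +
      Real.log (X ^ 2 + (2 * (n + 1 : ℕ) * h + d) ^ 2) =
    2 * Real.log ‖1 + (⟨X, d⟩ : ℂ) ^ 2 / (2 * (n + 1 : ℕ) * h : ℝ) ^ 2‖ +
      4 * Real.log (2 * (n + 1 : ℕ) * h) := by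
  set b : ℝ := 2 * (n + 1 : ℕ) * h with hb
  have hb2 : 2 * h ≤ b := by
    rw [hb]; push_cast
    have : 0 ≤ (n : ℝ) * h := by positivity
    nlinarith
  have hb0 : 0 < b := by linarith
  rw [abs_lt] at hd
  have p1 : 0 < X ^ 2 + (b - d) ^ 2 := by
    have : 0 < (b - d) ^ 2 := pow_pos (by linarith) 2
    positivity
  have p2 : 0 < X ^ 2 + (b + d) ^ 2 := by
    have : 0 < (b + d) ^ 2 := pow_pos (by linarith) 2
    positivity
  have key : ‖1 + (⟨X, d⟩ : ℂ) ^ 2 / (b : ℂ) ^ 2‖ ^ 2 * b ^ 4 =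
      (X ^ 2 + (b - d) ^ 2) * (X ^ 2 + (b + d) ^ 2) := by
    have hbC : (b : ℂ) ≠ 0 := by exact_mod_cast hb0.ne'
    have e : 1 + (⟨X, d⟩ : ℂ) ^ 2 / (b : ℂ) ^ 2 =
        (⟨X, d - b⟩ : ℂ) * (⟨X, d + b⟩ : ℂ) / (b ^ 2 : ℝ) := by
      have e1 : (⟨X, d - b⟩ : ℂ) * ⟨X, d + b⟩ = b ^ 2 + (⟨X, d⟩ : ℂ) ^ 2 := by
        apply Complex.ext
        · simp [sq]; ring
        · simp [sq]; ring
      rw [e1]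
      push_cast
      field_simp
    rw [e, norm_div, norm_mul, Complex.norm_real, Real.norm_of_nonneg (by positivity), div_pow,
      mul_pow, ← Complex.normSq_eq_norm_sq, ← Complex.normSq_eq_norm_sq, Complex.normSq_mk,
      Complex.normSq_mk]
    field_simp
    ring
  have hne : ‖1 + (⟨X, d⟩ : ℂ) ^ 2 / (b : ℂ) ^ 2‖ ≠ 0 := by
    intro h0
    rw [h0] at key
    have := mul_pos p1 p2
    rw [← key] at this
    simp at this
  refine ⟨fun h0 => hne (by rw [h0, norm_zero]), ?_⟩
  rw [← Real.log_mul p1.ne' p2.ne', ← key, Real.log_mul (by positivity) (by positivity),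
    Real.log_pow, Real.log_pow]
  norm_num

theorem tendsto_sum_imageTerm_log_norm {h s d : ℝ} (X : ℝ) (hh : 0 < h) (hs : |s| < 2 * h)
    (hd : |d| < 2 * h) :
    Tendsto (fun N : ℕ => ∑ n ∈ Finset.range N, imageTerm h s d X (n + 1)) atTop
      (𝓝 (2 * Real.log ‖dslope (fun w : ℂ => Complex.sinh ((Real.pi / (2 * h) : ℝ) * w)) 0 ⟨X, d⟩‖ -
        2 * Real.log
          ‖dslope (fun w : ℂ => Complex.sinh ((Real.pi / (2 * h) : ℝ) * w)) 0 ⟨X, s⟩‖)) := by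
  have hk : 0 < Real.pi / (2 * h) := by have := Real.pi_pos; positivity
  have hP : ∀ r : ℝ, |r| < 2 * h → Tendsto (fun N : ℕ => ∑ n ∈ Finset.range N,
      Real.log ‖1 + (⟨X, r⟩ : ℂ) ^ 2 / (2 * (n + 1 : ℕ) * h : ℝ) ^ 2‖) atTop
      (𝓝 (Real.log ‖dslope (fun w : ℂ => Complex.sinh ((Real.pi / (2 * h) : ℝ) * w)) 0 ⟨X, r⟩‖ -
        Real.log (Real.pi / (2 * h)))) := by
    intro r hr
    have hne : dslope (fun w : ℂ => Complex.sinh ((Real.pi / (2 * h) : ℝ) * w)) 0 ⟨X, r⟩ ≠ 0 := by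
      refine dslope_sinh_mul_ne_zero hk ?_
      rw [div_div_eq_mul_div, mul_div_cancel_left₀ _ Real.pi_ne_zero]
      exact hr
    have h1 := ((tendsto_prod_one_add_sq_div hh ⟨X, r⟩).norm).log (by
      simp only [ne_eq, norm_eq_zero, div_eq_zero_iff, not_or]
      exact ⟨hne, by exact_mod_cast hk.ne'⟩)
    rw [norm_div, Complex.norm_real, Real.norm_of_nonneg hk.le,
      Real.log_div (norm_ne_zero_iff.2 hne) hk.ne'] at h1
    refine h1.congr fun N => ?_
    rw [norm_prod, Real.log_prod]
    exact fun n _ => norm_ne_zero_iff.2 (log_add_log_eq_log_norm_one_add hh hr n).1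
  have h2 := ((hP d hd).const_mul 2).sub ((hP s hs).const_mul 2)
  rw [show ∀ a b c : ℝ, 2 * (a - b) - 2 * (c - b) = 2 * a - 2 * c by intros; ring] at h2
  refine h2.congr fun N => ?_
  rw [Finset.mul_sum, Finset.mul_sum, ← Finset.sum_sub_distrib]
  refine Finset.sum_congr rfl fun n _ => ?_
  rw [imageTerm, (log_add_log_eq_log_norm_one_add hh hd n).2, sub_sub,
    (log_add_log_eq_log_norm_one_add hh hs n).2]
  ring

/-- The partial products of the image form, with the logarithm of the central factor split off. -/
theorem log_prod_images {h s d X : ℝ} (hh : 0 < h) (hs : |s| < 2 * h) (hd : |d| < 2 * h)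
    (hd0 : X ^ 2 + d ^ 2 ≠ 0) (hs0 : X ^ 2 + s ^ 2 ≠ 0) (N : ℕ) :
    (∏ n ∈ Finset.Icc (-(N : ℤ)) (N : ℤ),
      (X ^ 2 + (d - 2 * (n : ℝ) * h) ^ 2) / (X ^ 2 + (s + 2 * (n : ℝ) * h) ^ 2) ≠ 0) ∧
    Real.log (∏ n ∈ Finset.Icc (-(N : ℤ)) (N : ℤ),
      (X ^ 2 + (d - 2 * (n : ℝ) * h) ^ 2) / (X ^ 2 + (s + 2 * (n : ℝ) * h) ^ 2)) =
    Real.log (X ^ 2 + d ^ 2) - Real.log (X ^ 2 + s ^ 2) +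
      ∑ n ∈ Finset.range N, imageTerm h s d X (n + 1) := by
  induction N with
  | zero =>
    simp only [Nat.cast_zero, neg_zero, Finset.Icc_self, Finset.prod_singleton, Int.cast_zero,
      mul_zero, zero_mul, sub_zero, add_zero, Finset.range_zero, Finset.sum_empty]
    exact ⟨div_ne_zero hd0 hs0, Real.log_div hd0 hs0⟩
  | succ N ih =>
    have hIcc : Finset.Icc (-((N + 1 : ℕ) : ℤ)) ((N + 1 : ℕ) : ℤ) =
        insert (-((N + 1 : ℕ) : ℤ)) (insert ((N + 1 : ℕ) : ℤ) (Finset.Icc (-(N : ℤ)) (N : ℤ))) := by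
      ext k
      simp only [Finset.mem_insert, Finset.mem_Icc]
      omega
    have hpos : ∀ r : ℝ, |r| < 2 * h → 0 < X ^ 2 + (2 * (N + 1 : ℕ) * h - r) ^ 2 ∧
        0 < X ^ 2 + (2 * (N + 1 : ℕ) * h + r) ^ 2 := by
      intro r hr
      rw [abs_lt] at hr
      have : 0 ≤ (N : ℝ) * h := by positivity
      have h1 : 0 < (2 * (N + 1 : ℕ) * h - r) ^ 2 := pow_pos (by push_cast; nlinarith) 2
      have h2 : 0 < (2 * (N + 1 : ℕ) * h + r) ^ 2 := pow_pos (by push_cast; nlinarith) 2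
      constructor <;> positivity
    obtain ⟨d1, d2⟩ := hpos d hd
    obtain ⟨s1, s2⟩ := hpos s hs
    rw [hIcc, Finset.prod_insert, Finset.prod_insert]
    · have e1 : (d - 2 * ((-((N + 1 : ℕ) : ℤ) : ℤ) : ℝ) * h) ^ 2 = (2 * (N + 1 : ℕ) * h + d) ^ 2 := by
        push_cast; ring
      have e2 : (s + 2 * ((-((N + 1 : ℕ) : ℤ) : ℤ) : ℝ) * h) ^ 2 = (2 * (N + 1 : ℕ) * h - s) ^ 2 := by
        push_cast; ring
      have e3 : (d - 2 * ((((N + 1 : ℕ) : ℤ) : ℤ) : ℝ) * h) ^ 2 = (2 * (N + 1 : ℕ) * h - d) ^ 2 := by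
        push_cast; ring
      have e4 : (s + 2 * ((((N + 1 : ℕ) : ℤ) : ℤ) : ℝ) * h) ^ 2 = (2 * (N + 1 : ℕ) * h + s) ^ 2 := by
        push_cast; ring
      rw [e1, e2, e3, e4]
      have f1 := (div_pos d2 s1).ne'
      have f2 := (div_pos d1 s2).ne'
      refine ⟨mul_ne_zero f1 (mul_ne_zero f2 ih.1), ?_⟩
      rw [Real.log_mul f1 (mul_ne_zero f2 ih.1), Real.log_mul f2 ih.1, ih.2,
        Real.log_div d2.ne' s1.ne', Real.log_div d1.ne' s2.ne', Finset.sum_range_succ, imageTerm]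
      ring
    · simp
    · simp only [Finset.mem_insert, Finset.mem_Icc]
      omega

/-! ### The Laplacian of the logarithm in the sense of distributions -/

section
variable {φ : ℂ → ℝ}

theorem continuous_laplacian (hφ : ContDiff ℝ ∞ φ) (hc : HasCompactSupport φ) :
    Continuous (Laplacian.laplacian φ) := by
  have : Laplacian.laplacian φ = ⇑(Laplacian.laplacian (hc.toSchwartzMap hφ)) := by
    ext x
    rw [SchwartzMap.laplacian_apply]
    rfl
  rw [this]
  exact SchwartzMap.continuous _

theorem laplacian_eq_zero_of_notMem_tsupport {p : ℂ} (hp : p ∉ tsupport φ) :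
    Laplacian.laplacian φ p = 0 := by
  have h : φ =ᶠ[𝓝 p] fun _ => 0 := by
    filter_upwards [(isClosed_tsupport φ).isOpen_compl.mem_nhds hp] with q hq
    exact image_eq_zero_of_notMem_tsupport hq
  rw [(InnerProductSpace.laplacian_congr_nhds h).eq_of_nhds]
  simp

theorem hasCompactSupport_laplacian (hc : HasCompactSupport φ) :
    HasCompactSupport (Laplacian.laplacian φ) :=
  HasCompactSupport.intro hc fun _ hp => laplacian_eq_zero_of_notMem_tsupport hp

/-- Integration by parts against a test function, for a function that is smooth only near the support
of the test function: multiply it by a cutoff and apply the identity for Schwartz functions. -/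
theorem integral_mul_laplacian_of_contDiffAt {Ω : Set ℂ} (hΩ : IsOpen Ω) {f : ℂ → ℝ}
    (hf : ∀ p ∈ Ω, ContDiffAt ℝ ∞ f p) (hφ : ContDiff ℝ ∞ φ) (hc : HasCompactSupport φ)
    (hs : tsupport φ ⊆ Ω) :
    ∫ p, f p * Laplacian.laplacian φ p = ∫ p, Laplacian.laplacian f p * φ p := by
  obtain ⟨K, hK, hφK, hKΩ⟩ := exists_compact_between hc hΩ hs
  obtain ⟨χ, hχ1, hχ0, -⟩ := exists_contMDiffMap_one_nhds_of_subset_interior (n := ⊤)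
    (modelWithCornersSelf ℝ ℂ) (isClosed_tsupport φ) hφK
  have hχ : ContDiff ℝ ∞ χ := χ.contMDiff.contDiff
  have hsupp : HasCompactSupport (fun p => χ p * f p) :=
    HasCompactSupport.intro hK fun p hp => by simp [hχ0 p hp]
  have hsmooth : ContDiff ℝ ∞ (fun p => χ p * f p) := by
    rw [contDiff_iff_contDiffAt]
    intro p
    by_cases hp : p ∈ K
    · exact hχ.contDiffAt.mul (hf p (hKΩ hp))
    · refine (contDiffAt_const (c := (0 : ℝ))).congr_of_eventuallyEq ?_
      filter_upwards [hK.isClosed.isOpen_compl.mem_nhds hp] with q hq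
      simp [hχ0 q hq]
  have key := SchwartzMap.integral_mul_laplacian_right_eq_left (μ := volume)
    (hsupp.toSchwartzMap hsmooth) (hc.toSchwartzMap hφ)
  simp only [SchwartzMap.laplacian_apply] at key
  have e1 : ∀ p ∈ tsupport φ, (fun q => χ q * f q) =ᶠ[𝓝 p] f := by
    intro p hp
    filter_upwards [eventually_nhdsSet_iff_forall.1 hχ1 p hp] with q hq
    rw [hq, one_mul]
  calc ∫ p, f p * Laplacian.laplacian φ p
      = ∫ p, (χ p * f p) * Laplacian.laplacian φ p := by
        refine integral_congr_ae (Eventually.of_forall fun p => ?_)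
        by_cases hp : p ∈ tsupport φ
        · have h1 := (e1 p hp).eq_of_nhds
          simp only at h1 ⊢
          rw [h1]
        · simp [laplacian_eq_zero_of_notMem_tsupport hp]
    _ = ∫ p, Laplacian.laplacian (fun q => χ q * f q) p * φ p := key
    _ = ∫ p, Laplacian.laplacian f p * φ p := by
        refine integral_congr_ae (Eventually.of_forall fun p => ?_)
        by_cases hp : p ∈ tsupport φ
        · simp only
          rw [(InnerProductSpace.laplacian_congr_nhds (e1 p hp)).eq_of_nhds]
        · simp [image_eq_zero_of_notMem_tsupport hp]

theorem integral_mul_laplacian_eq_zero_of_harmonicOnNhd {Ω : Set ℂ} (hΩ : IsOpen Ω) {f : ℂ → ℝ}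
    (hf : InnerProductSpace.HarmonicOnNhd f Ω) (hφ : ContDiff ℝ ∞ φ) (hc : HasCompactSupport φ)
    (hs : tsupport φ ⊆ Ω) : ∫ p, f p * Laplacian.laplacian φ p = 0 := by
  rw [integral_mul_laplacian_of_contDiffAt hΩ
    (fun p hp => (HarmonicAt.analyticAt (hf p hp)).contDiffAt) hφ hc hs]
  rw [← integral_zero ℂ ℝ]
  refine integral_congr_ae (Eventually.of_forall fun p => ?_)
  by_cases hp : p ∈ tsupport φ
  · simp [(hf p (hs hp)).2.eq_of_nhds]
  · simp [image_eq_zero_of_notMem_tsupport hp]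

end

theorem contDiff_log_norm_sq_add {ε : ℝ} (hε : 0 < ε) (p₀ : ℂ) :
    ContDiff ℝ ∞ (fun p : ℂ => Real.log (‖p - p₀‖ ^ 2 + ε ^ 2)) :=
  ((contDiff_id.sub contDiff_const).norm_sq ℝ |>.add contDiff_const).log
    fun p => by positivity

theorem laplacian_log_norm_sq_add {ε : ℝ} (hε : 0 < ε) (p₀ p : ℂ) :
    Laplacian.laplacian (fun p : ℂ => Real.log (‖p - p₀‖ ^ 2 + ε ^ 2)) p =
      4 * ε ^ 2 / (‖p - p₀‖ ^ 2 + ε ^ 2) ^ 2 := by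
  have hpos : ∀ q : ℂ, 0 < ‖q - p₀‖ ^ 2 + ε ^ 2 := fun q => by positivity
  have hsq : ∀ q : ℂ, HasFDerivAt (fun q : ℂ => ‖q - p₀‖ ^ 2 + ε ^ 2)
      (2 • innerSL ℝ (q - p₀)) q := by
    intro q
    have := ((hasFDerivAt_id q).sub_const p₀).norm_sq
    simpa using this.add_const (ε ^ 2)
  have h1 : fderiv ℝ (fun q : ℂ => Real.log (‖q - p₀‖ ^ 2 + ε ^ 2)) =
      fun q => (‖q - p₀‖ ^ 2 + ε ^ 2)⁻¹ • (2 • innerSL ℝ (q - p₀)) := by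
    ext1 q
    exact ((hsq q).log (hpos q).ne').fderiv
  have h2 : HasFDerivAt (fun q : ℂ => (‖q - p₀‖ ^ 2 + ε ^ 2)⁻¹ • (2 • innerSL ℝ (q - p₀)))
      ((‖p - p₀‖ ^ 2 + ε ^ 2)⁻¹ • (2 • (innerSL ℝ : ℂ →L[ℝ] ℂ →L[ℝ] ℝ)) +
        ((-((‖p - p₀‖ ^ 2 + ε ^ 2) ^ 2)⁻¹) • (2 • innerSL ℝ (p - p₀))).smulRight
          (2 • innerSL ℝ (p - p₀))) p := by
    have hin : HasFDerivAt (fun q : ℂ => 2 • innerSL ℝ (q - p₀))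
        (2 • (innerSL ℝ : ℂ →L[ℝ] ℂ →L[ℝ] ℝ)) p :=
      ((innerSL ℝ : ℂ →L[ℝ] ℂ →L[ℝ] ℝ).hasFDerivAt.comp p
        ((hasFDerivAt_id p).sub_const p₀)).const_smul 2
    have hinv := (hasDerivAt_inv (hpos p).ne').comp_hasFDerivAt p (hsq p)
    exact hinv.smul hin
  rw [InnerProductSpace.laplacian_eq_iteratedFDeriv_complexPlane]
  simp only [iteratedFDeriv_two_apply, h1, h2.fderiv]
  simp [Complex.inner, innerSL_apply_apply ℝ]
  have h3 : ‖p - p₀‖ ^ 2 = (p.re - p₀.re) ^ 2 + (p.im - p₀.im) ^ 2 := by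
    rw [← Complex.normSq_eq_norm_sq, Complex.normSq_apply]; simp; ring
  have h4 := hpos p
  rw [h3] at h4 ⊢
  field_simp
  ring

theorem integral_inv_one_add_norm_sq_sq :
    ∫ q : ℂ, ((1 + ‖q‖ ^ 2) ^ 2)⁻¹ = Real.pi := by
  have h := integral_fun_norm_addHaar (volume : Measure ℂ) (fun r : ℝ => ((1 + r ^ 2) ^ 2)⁻¹)
  rw [h, Complex.finrank_real_complex]
  have hball : (volume : Measure ℂ).real (Metric.ball 0 1) = Real.pi := by
    simp [Measure.real, Complex.volume_ball]
  rw [hball]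
  have hint : ∫ y in Ioi (0 : ℝ), y ^ (2 - 1) • ((1 + y ^ 2) ^ 2)⁻¹ = 1 / 2 := by
    have hd : ∀ y ∈ Ici (0 : ℝ), HasDerivAt (fun y : ℝ => -(1 + y ^ 2)⁻¹ / 2)
        (y ^ (2 - 1) • ((1 + y ^ 2) ^ 2)⁻¹) y := by
      intro y _
      have hy : (1 + y ^ 2) ≠ 0 := by positivity
      have := ((((hasDerivAt_pow 2 y).const_add 1).inv hy).neg).div_const 2
      refine this.congr_deriv ?_
      simp only [smul_eq_mul]
      field_simp
      norm_num
      ring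
    have hlim : Tendsto (fun y : ℝ => -(1 + y ^ 2)⁻¹ / 2) atTop (𝓝 (-0 / 2)) := by
      refine (Tendsto.neg (tendsto_inv_atTop_zero.comp ?_)).div_const 2
      exact tendsto_atTop_add_const_left _ _ (tendsto_pow_atTop two_ne_zero)
    have := integral_Ioi_of_hasDerivAt_of_nonneg' hd
      (fun y hy => by have : 0 < y := hy; simp; positivity) hlim
    rw [this]
    norm_num
  rw [hint]
  simp only [nsmul_eq_mul, smul_eq_mul]
  push_cast
  ring

theorem integrable_inv_one_add_norm_sq_sq :
    Integrable (fun q : ℂ => ((1 + ‖q‖ ^ 2) ^ 2)⁻¹) := by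
  -- By convention a function that is not integrable has integral `0`, but this integral is `π`.
  by_contra h
  have := integral_inv_one_add_norm_sq_sq
  rw [integral_undef h] at this
  exact Real.pi_ne_zero this.symm

/-- The substitution `p = p₀ + ε q`, after which the limit `ε → 0` is dominated. -/
theorem integral_laplacian_log_mul_eq_rescaled {φ : ℂ → ℝ} (p₀ : ℂ) {ε : ℝ} (hε : 0 < ε) :
    ∫ p : ℂ, 4 * ε ^ 2 / (‖p - p₀‖ ^ 2 + ε ^ 2) ^ 2 * φ p =
      ∫ q : ℂ, 4 * ((1 + ‖q‖ ^ 2) ^ 2)⁻¹ * φ (p₀ + ε • q) := by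
  have h1 := Measure.integral_comp_smul (volume : Measure ℂ)
    (fun q : ℂ => 4 * ε ^ 2 / (‖q‖ ^ 2 + ε ^ 2) ^ 2 * φ (p₀ + q)) ε
  rw [Complex.finrank_real_complex, abs_of_pos (by positivity), smul_eq_mul] at h1
  have h2 := integral_sub_right_eq_self (μ := (volume : Measure ℂ))
    (fun q : ℂ => 4 * ε ^ 2 / (‖q‖ ^ 2 + ε ^ 2) ^ 2 * φ (p₀ + q)) p₀
  simp only [add_sub_cancel] at h2
  rw [h2]
  have h3 : ∀ q : ℂ, 4 * ((1 + ‖q‖ ^ 2) ^ 2)⁻¹ * φ (p₀ + ε • q) =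
      ε ^ 2 * (4 * ε ^ 2 / (‖ε • q‖ ^ 2 + ε ^ 2) ^ 2 * φ (p₀ + ε • q)) := by
    intro q
    rw [norm_smul, Real.norm_of_nonneg hε.le]
    have : 0 < 1 + ‖q‖ ^ 2 := by positivity
    have : (ε * ‖q‖) ^ 2 + ε ^ 2 = ε ^ 2 * (1 + ‖q‖ ^ 2) := by ring
    rw [this]
    field_simp
  simp_rw [h3]
  rw [integral_const_mul, h1]
  field_simp

theorem locallyIntegrable_log_norm_sq (p₀ : ℂ) :
    LocallyIntegrable (fun p : ℂ => Real.log (‖p - p₀‖ ^ 2)) := by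
  have h0 : ∀ R : ℝ, IntegrableOn (fun p : ℂ => Real.log (‖p‖ ^ 2)) (Metric.ball 0 R) := by
    intro R
    rw [integrableOn_fun_norm_addHaar (volume : Measure ℂ) (f := fun r : ℝ => Real.log (r ^ 2)),
      Complex.finrank_real_complex]
    have : Continuous (fun y : ℝ => 2 * (y * Real.log y)) := Real.continuous_mul_log.const_mul 2
    refine ((this.integrableOn_Icc (a := 0) (b := R)).mono_set Ioo_subset_Icc_self).congr_fun ?_
      measurableSet_Ioo
    intro y _
    simp [Real.log_pow]
    ring
  intro p
  refine ⟨Metric.ball p₀ (dist p p₀ + 1), Metric.isOpen_ball.mem_nhds (by simp), ?_⟩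
  have h1 := (measurePreserving_sub_right (volume : Measure ℂ) p₀).integrableOn_comp_preimage
    (MeasurableEquiv.subRight p₀).measurableEmbedding (f := fun p : ℂ => Real.log (‖p‖ ^ 2))
    (s := Metric.ball 0 (dist p p₀ + 1))
  have h2 := h1.2 (h0 _)
  have hball : Metric.ball p₀ (dist p p₀ + 1) =
      (fun x => x - p₀) ⁻¹' Metric.ball 0 (dist p p₀ + 1) := by
    ext q
    simp [dist_eq_norm]
  rw [hball]
  exact h2

/-- `log ‖p - p₀‖ ^ 2` is `4 π` times the fundamental solution of the Laplacian in the plane. -/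
theorem integral_log_norm_sq_mul_laplacian {φ : ℂ → ℝ} (hφ : ContDiff ℝ ∞ φ)
    (hc : HasCompactSupport φ) (p₀ : ℂ) :
    ∫ p : ℂ, Real.log (‖p - p₀‖ ^ 2) * Laplacian.laplacian φ p = 4 * Real.pi * φ p₀ := by
  set ε : ℕ → ℝ := fun n => 1 / ((n : ℝ) + 1) with hε
  have hε0 : ∀ n, 0 < ε n := fun n => by positivity
  have hε1 : ∀ n, ε n ≤ 1 := fun n => by
    rw [hε]; exact div_le_one_of_le₀ (by simp) (by positivity)
  have hεlim : Tendsto ε atTop (𝓝 0) := tendsto_one_div_add_atTop_nhds_zero_nat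
  have heq : ∀ n, ∫ p : ℂ, Real.log (‖p - p₀‖ ^ 2 + ε n ^ 2) * Laplacian.laplacian φ p =
      ∫ q : ℂ, 4 * ((1 + ‖q‖ ^ 2) ^ 2)⁻¹ * φ (p₀ + ε n • q) := by
    intro n
    rw [← integral_laplacian_log_mul_eq_rescaled p₀ (hε0 n),
      integral_mul_laplacian_of_contDiffAt isOpen_univ
      (fun p _ => (contDiff_log_norm_sq_add (hε0 n) p₀).contDiffAt) hφ hc (subset_univ _)]
    simp_rw [laplacian_log_norm_sq_add (hε0 n)]
  have hΔc := continuous_laplacian hφ hc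
  have hΔs := hasCompactSupport_laplacian hc
  have hL : Tendsto (fun n => ∫ p : ℂ, Real.log (‖p - p₀‖ ^ 2 + ε n ^ 2) *
      Laplacian.laplacian φ p) atTop
      (𝓝 (∫ p : ℂ, Real.log (‖p - p₀‖ ^ 2) * Laplacian.laplacian φ p)) := by
    have hcont : Continuous (fun p : ℂ => Real.log (‖p - p₀‖ ^ 2 + 1)) :=
      Continuous.log (by fun_prop) fun p => by positivity
    refine tendsto_integral_of_dominated_convergence
      (fun p => ‖Real.log (‖p - p₀‖ ^ 2) * Laplacian.laplacian φ p‖ +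
        ‖Real.log (‖p - p₀‖ ^ 2 + 1) * Laplacian.laplacian φ p‖) ?_ ?_ ?_ ?_
    · intro n
      exact ((contDiff_log_norm_sq_add (hε0 n) p₀).continuous.mul hΔc).aestronglyMeasurable
    · refine Integrable.add (Integrable.norm ?_) (Integrable.norm ?_)
      · have := (locallyIntegrable_log_norm_sq p₀).integrable_smul_right_of_hasCompactSupport
          hΔc hΔs
        simpa only [smul_eq_mul] using this
      · exact (hcont.mul hΔc).integrable_of_hasCompactSupport hΔs.mul_left
    · intro n
      -- Off the pole `log ‖p - p₀‖ ^ 2 ≤ log (‖p - p₀‖ ^ 2 + ε ^ 2) ≤ log (‖p - p₀‖ ^ 2 + 1)`.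
      have hne : ∀ᵐ p : ℂ, p ≠ p₀ := by
        simp [ae_iff]
      filter_upwards [hne] with p hp
      have hp' : 0 < ‖p - p₀‖ ^ 2 := by
        have := norm_pos_iff.2 (sub_ne_zero.2 hp)
        positivity
      rw [norm_mul, norm_mul, norm_mul, ← add_mul]
      refine mul_le_mul_of_nonneg_right ?_ (norm_nonneg _)
      rw [Real.norm_eq_abs, Real.norm_eq_abs, Real.norm_eq_abs]
      have hsq : ε n ^ 2 ≤ 1 := pow_le_one₀ (hε0 n).le (hε1 n)
      have l1 : Real.log (‖p - p₀‖ ^ 2) ≤ Real.log (‖p - p₀‖ ^ 2 + ε n ^ 2) :=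
        Real.log_le_log hp' (by linarith [sq_nonneg (ε n)])
      have l2 : Real.log (‖p - p₀‖ ^ 2 + ε n ^ 2) ≤ Real.log (‖p - p₀‖ ^ 2 + 1) :=
        Real.log_le_log (by positivity) (by linarith)
      rw [abs_le]
      constructor
      · linarith [neg_abs_le (Real.log (‖p - p₀‖ ^ 2)), abs_nonneg (Real.log (‖p - p₀‖ ^ 2 + 1))]
      · linarith [le_abs_self (Real.log (‖p - p₀‖ ^ 2 + 1)), abs_nonneg (Real.log (‖p - p₀‖ ^ 2))]
    · have hne : ∀ᵐ p : ℂ, p ≠ p₀ := by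
        simp [ae_iff]
      filter_upwards [hne] with p hp
      have hp' : ‖p - p₀‖ ^ 2 ≠ 0 := by
        have := norm_pos_iff.2 (sub_ne_zero.2 hp)
        positivity
      refine Tendsto.mul_const _ (Tendsto.log ?_ hp')
      simpa using (hεlim.pow 2).const_add (‖p - p₀‖ ^ 2)
  obtain ⟨B, hB⟩ := hφ.continuous.bounded_above_of_compact_support hc
  have hR : Tendsto (fun n => ∫ q : ℂ, 4 * ((1 + ‖q‖ ^ 2) ^ 2)⁻¹ * φ (p₀ + ε n • q)) atTop
      (𝓝 (∫ q : ℂ, 4 * ((1 + ‖q‖ ^ 2) ^ 2)⁻¹ * φ p₀)) := by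
    refine tendsto_integral_of_dominated_convergence
      (fun q => 4 * ((1 + ‖q‖ ^ 2) ^ 2)⁻¹ * B) ?_ ?_ ?_ ?_
    · intro n
      have := hφ.continuous
      exact (integrable_inv_one_add_norm_sq_sq.aestronglyMeasurable.const_mul 4).mul
        (Continuous.aestronglyMeasurable (by fun_prop))
    · exact (integrable_inv_one_add_norm_sq_sq.const_mul 4).mul_const B
    · refine fun n => Eventually.of_forall fun q => ?_
      rw [norm_mul, Real.norm_of_nonneg (by positivity)]
      exact mul_le_mul_of_nonneg_left (hB _) (by positivity)
    · refine Eventually.of_forall fun q => Tendsto.const_mul _ ?_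
      refine (hφ.continuous.tendsto p₀).comp ?_
      simpa using (hεlim.smul_const q).const_add p₀
  simp_rw [heq] at hL
  rw [tendsto_nhds_unique hL hR, integral_mul_const, integral_const_mul,
    integral_inv_one_add_norm_sq_sq]

/-! ### The Green function of the strip -/

section
variable {h x₀ z₀ : ℝ}

theorem isMultiplierImage_sinhRatio {a c : ℝ} (hh : 0 < h) (ha : |a| ≤ h) (hc : 0 < c) (x₀ : ℝ) :
    IsMultiplierImage (sinhRatio a h) (fun y => Real.log ((y - x₀) ^ 2 + c ^ 2))
      (fun x => multiplierLog (sinhRatio a h) c (x - x₀)) := by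
  obtain ⟨L, -, hL⟩ := exists_abs_sinhRatio_sub_le hh ha
  exact isMultiplierImage_multiplierLog (hasTemperateGrowth_sinhRatio_two_pi hh ha) sinhRatio_neg
    (continuous_sinhRatio hh ha) (abs_sinhRatio_le_one hh ha) hL hc x₀

/-- The first multiplier term at height `z`, which carries the boundary data on `z = 0`. -/
theorem isMultiplierImage_top (hh : 0 < h) (hz₀ : -h < z₀ ∧ z₀ < 0) {z : ℝ} (hz : -h ≤ z)
    (hz' : z ≤ 0) :
    IsMultiplierImage (sinhRatio (z + h) h) (fun y : ℝ => Real.log ((y - x₀) ^ 2 + z₀ ^ 2))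
      (fun x => multiplierLog (sinhRatio (z + h) h) (-z₀) (x - x₀)) := by
  have := isMultiplierImage_sinhRatio (a := z + h) (c := -z₀) hh
    (by rw [abs_le]; constructor <;> linarith) (by linarith [hz₀.2]) x₀
  simpa only [neg_sq] using this

/-- The second multiplier term at height `z`, which carries the boundary data on `z = -h`. -/
theorem isMultiplierImage_bottom (hh : 0 < h) (hz₀ : -h < z₀ ∧ z₀ < 0) {z : ℝ} (hz : -h ≤ z)
    (hz' : z ≤ 0) :
    IsMultiplierImage (sinhRatio z h) (fun y : ℝ => Real.log ((y - x₀) ^ 2 + (h + z₀) ^ 2))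
      (fun x => multiplierLog (sinhRatio z h) (h + z₀) (x - x₀)) :=
  isMultiplierImage_sinhRatio hh (by rw [abs_le]; constructor <;> linarith)
    (by linarith [hz₀.1]) x₀

/-- `4 π` times the correction of the free Green function, in closed form: twice the logarithm of
`‖sinh (κ (p - conj p₀)) / (sinh (κ (p - p₀)) / (p - p₀))‖`, where `κ = π / (2 h)`. The divided
difference extends the denominator across `p = p₀`. -/
noncomputable def stripCorrection (h : ℝ) (p₀ p : ℂ) : ℝ :=
  2 * Real.log ‖Complex.sinh ((Real.pi / (2 * h) : ℝ) * (p - (starRingEnd ℂ) p₀))‖ -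
    2 * Real.log ‖dslope (fun w : ℂ => Complex.sinh ((Real.pi / (2 * h) : ℝ) * w)) 0 (p - p₀)‖

theorem log_sq_add_sq_eq (X s : ℝ) :
    Real.log (X ^ 2 + s ^ 2) = 2 * Real.log ‖(⟨X, s⟩ : ℂ)‖ := by
  rw [Complex.norm_def, Real.log_sqrt (Complex.normSq_nonneg _), Complex.normSq_mk]
  ring_nf

/-- The two multiplier terms together are the logarithm of the first image, located at the reflection
of the pole in the line `z = 0`, minus the contribution of all other images. -/
theorem multiplierLog_sub_multiplierLog_eq {z : ℝ} (hh : 0 < h) (hz₀ : -h < z₀ ∧ z₀ < 0)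
    (hz : -h ≤ z) (hz' : z ≤ 0) (X : ℝ) :
    IntegrableOn (fun t => Real.cos (X * t) * imageKernel h (z + z₀) (z - z₀) t) (Ioi 0) ∧
    multiplierLog (sinhRatio (z + h) h) (-z₀) X - multiplierLog (sinhRatio z h) (h + z₀) X =
      Real.log (X ^ 2 + (z + z₀) ^ 2) - 2 * ∫ t in Ioi (0 : ℝ),
        Real.cos (X * t) * imageKernel h (z + z₀) (z - z₀) t := by
  have ha1 : |z + h| ≤ h := by rw [abs_le]; constructor <;> linarith
  have ha2 : |z| ≤ h := by rw [abs_le]; constructor <;> linarith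
  obtain ⟨L1, -, hL1⟩ := exists_abs_sinhRatio_sub_le hh ha1
  obtain ⟨L2, -, hL2⟩ := exists_abs_sinhRatio_sub_le hh ha2
  have i1 := integrableOn_logKernel (c := -z₀) (continuous_sinhRatio hh ha1)
    (abs_sinhRatio_le_one hh ha1) hL1 (by linarith [hz₀.2]) X
  have i2 := integrableOn_logKernel (c := h + z₀) (continuous_sinhRatio hh ha2)
    (abs_sinhRatio_le_one hh ha2) hL2 (by linarith [hz₀.1]) X
  have hs : 0 < -(z + z₀) := by linarith [hz₀.2]
  have i3 := integrableOn_logKernel_one hs X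
  have heq : ∀ t ∈ Ioi (0 : ℝ), Real.cos (X * t) * imageKernel h (z + z₀) (z - z₀) t =
      logKernel (fun _ => 1) (-(z + z₀)) X t -
        (logKernel (sinhRatio (z + h) h) (-z₀) X t - logKernel (sinhRatio z h) (h + z₀) X t) := by
    intro t ht
    rw [logKernel_sinhRatio_sub_logKernel_sinhRatio hh ht]
    ring
  refine ⟨(i3.sub (i1.sub i2)).congr_fun (fun t ht => (heq t ht).symm) measurableSet_Ioi, ?_⟩
  have hadd := integral_sub i3 (i1.sub i2)
  simp only [Pi.sub_apply] at hadd
  rw [setIntegral_congr_fun measurableSet_Ioi heq, hadd, integral_sub i1 i2, mul_sub,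
    two_mul_integral_logKernel_one hs, neg_sq, multiplierLog, multiplierLog]
  ring

theorem abs_add_lt_two_mul (hz₀ : -h < z₀ ∧ z₀ < 0) {z : ℝ} (hz : -h ≤ z) (hz' : z ≤ 0) :
    |z + z₀| < 2 * h := by
  rw [abs_lt]; constructor <;> linarith [hz₀.1, hz₀.2]

theorem abs_sub_lt_two_mul (hz₀ : -h < z₀ ∧ z₀ < 0) {z : ℝ} (hz : -h ≤ z) (hz' : z ≤ 0) :
    |z - z₀| < 2 * h := by
  rw [abs_lt]; constructor <;> linarith [hz₀.1, hz₀.2]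

theorem sinh_ne_zero_of_abs_lt (hh : 0 < h) {X d : ℝ} (hd : |d| < 2 * h) (hne : X ≠ 0 ∨ d ≠ 0) :
    Complex.sinh ((Real.pi / (2 * h) : ℝ) * (⟨X, d⟩ : ℂ)) ≠ 0 := by
  have hk : 0 < Real.pi / (2 * h) := by have := Real.pi_pos; positivity
  have hne' : (⟨X, d⟩ : ℂ) ≠ 0 := by
    intro h0
    rw [Complex.ext_iff] at h0
    exact hne.elim (fun hX => hX h0.1) fun hd => hd h0.2
  refine Complex.sinh_ne_zero_of_abs_im_lt (mul_ne_zero (by exact_mod_cast hk.ne') hne') ?_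
  rw [Complex.im_ofReal_mul, abs_mul, abs_of_pos hk, div_mul_eq_mul_div,
    div_lt_iff₀ (by positivity)]
  exact mul_lt_mul_of_pos_left hd Real.pi_pos

/-- The closed form follows by comparing the two evaluations of the image series,
`tendsto_sum_imageTerm` and `tendsto_sum_imageTerm_log_norm`. -/
theorem multiplierLog_sub_multiplierLog_eq_stripCorrection {z : ℝ} (hh : 0 < h)
    (hz₀ : -h < z₀ ∧ z₀ < 0) (hz : -h ≤ z) (hz' : z ≤ 0) (x : ℝ) :
    multiplierLog (sinhRatio (z + h) h) (-z₀) (x - x₀) -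
      multiplierLog (sinhRatio z h) (h + z₀) (x - x₀) = stripCorrection h ⟨x₀, z₀⟩ ⟨x, z⟩ := by
  obtain ⟨hint, heq⟩ := multiplierLog_sub_multiplierLog_eq hh hz₀ hz hz' (x - x₀)
  have hs := abs_add_lt_two_mul hz₀ hz hz'
  have hd := abs_sub_lt_two_mul hz₀ hz hz'
  rw [heq, tendsto_nhds_unique (tendsto_sum_imageTerm hh hs hd hint)
    (tendsto_sum_imageTerm_log_norm (x - x₀) hh hs hd)]
  have e1 : (⟨x, z⟩ : ℂ) - ⟨x₀, z₀⟩ = ⟨x - x₀, z - z₀⟩ := rfl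
  have e2 : (⟨x, z⟩ : ℂ) - (starRingEnd ℂ) ⟨x₀, z₀⟩ = ⟨x - x₀, z + z₀⟩ := by
    apply Complex.ext <;> simp
  have hne : (⟨x - x₀, z + z₀⟩ : ℂ) ≠ 0 := by
    intro h0
    have := congrArg Complex.im h0
    simp at this
    linarith [hz₀.2]
  have hS := sinh_ne_zero_of_abs_lt hh hs (X := x - x₀) (Or.inr (by linarith [hz₀.2]))
  rw [stripCorrection, e1, e2, dslope_sinh_mul_of_ne _ hne, norm_div,
    Real.log_div (norm_ne_zero_iff.2 hS) (norm_ne_zero_iff.2 hne), log_sq_add_sq_eq]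
  ring

theorem stripGreen_eq {z : ℝ} (hh : 0 < h) (hz₀ : -h < z₀ ∧ z₀ < 0) (hz : -h ≤ z) (hz' : z ≤ 0)
    (x : ℝ) :
    stripGreen h x₀ z₀ x z = 1 / (4 * Real.pi) * (Real.log ((x - x₀) ^ 2 + (z - z₀) ^ 2) -
      stripCorrection h ⟨x₀, z₀⟩ ⟨x, z⟩) := by
  rw [stripGreen, (isMultiplierImage_top hh hz₀ hz hz').multiplierApply_eq,
    (isMultiplierImage_bottom hh hz₀ hz hz').multiplierApply_eq,
    ← multiplierLog_sub_multiplierLog_eq_stripCorrection hh hz₀ hz hz']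
  ring

/-- The image form of the Green function. -/
theorem tendsto_stripGreen {z : ℝ} (hh : 0 < h) (hz₀ : -h < z₀ ∧ z₀ < 0) (hz : -h ≤ z)
    (hz' : z ≤ 0) {x : ℝ} (hne : (x, z) ≠ (x₀, z₀)) :
    Tendsto (fun N : ℕ => 1 / (4 * Real.pi) * Real.log
          (∏ n ∈ Finset.Icc (-(N : ℤ)) (N : ℤ),
            ((x - x₀) ^ 2 + (z - z₀ - 2 * (n : ℝ) * h) ^ 2) /
              ((x - x₀) ^ 2 + (z + z₀ + 2 * (n : ℝ) * h) ^ 2)))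
        atTop (𝓝 (stripGreen h x₀ z₀ x z)) := by
  obtain ⟨hint, heq⟩ := multiplierLog_sub_multiplierLog_eq hh hz₀ hz hz' (x - x₀)
  have hs := abs_add_lt_two_mul hz₀ hz hz'
  have hd := abs_sub_lt_two_mul hz₀ hz hz'
  have hd0 : (x - x₀) ^ 2 + (z - z₀) ^ 2 ≠ 0 := by
    intro h0
    refine hne (Prod.ext ?_ ?_)
    · have : x - x₀ = 0 := by nlinarith [sq_nonneg (x - x₀), sq_nonneg (z - z₀)]
      simpa [sub_eq_zero] using this
    · have : z - z₀ = 0 := by nlinarith [sq_nonneg (x - x₀), sq_nonneg (z - z₀)]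
      simpa [sub_eq_zero] using this
  have hs0 : (x - x₀) ^ 2 + (z + z₀) ^ 2 ≠ 0 := by
    have : 0 < (z + z₀) ^ 2 := by
      have : z + z₀ ≠ 0 := by linarith [hz₀.2]
      positivity
    positivity
  rw [stripGreen_eq hh hz₀ hz hz',
    ← multiplierLog_sub_multiplierLog_eq_stripCorrection hh hz₀ hz hz', heq]
  refine Tendsto.const_mul _ ?_
  simp_rw [(log_prod_images hh hs hd hd0 hs0 _).2]
  rw [← sub_add]
  exact (tendsto_sum_imageTerm hh hs hd hint).const_add _

theorem norm_sinh_sq_eq_cosh_sub_cos (w : ℂ) :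
    ‖Complex.sinh w‖ ^ 2 = (Real.cosh (2 * w.re) - Real.cos (2 * w.im)) / 2 := by
  rw [Complex.norm_sinh_sq, Real.cosh_two_mul, Real.cos_two_mul, Real.cosh_sq, Real.cos_sq']
  ring

theorem cosh_sub_cos_eq (hh : 0 < h) (X d : ℝ) :
    Real.cosh (Real.pi / h * X) - Real.cos (Real.pi / h * d) =
      2 * ‖Complex.sinh ((Real.pi / (2 * h) : ℝ) * (⟨X, d⟩ : ℂ))‖ ^ 2 := by
  have hY : ∀ Y : ℝ, 2 * (Real.pi / (2 * h) * Y) = Real.pi / h * Y := fun Y => by field_simp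
  rw [norm_sinh_sq_eq_cosh_sub_cos, Complex.re_ofReal_mul, Complex.im_ofReal_mul, hY, hY]
  ring

theorem cosh_sub_cos_pos (hh : 0 < h) {X d : ℝ} (hd : |d| < 2 * h) (hne : X ≠ 0 ∨ d ≠ 0) :
    0 < Real.cosh (Real.pi / h * X) - Real.cos (Real.pi / h * d) := by
  rw [cosh_sub_cos_eq hh]
  have := norm_pos_iff.2 (sinh_ne_zero_of_abs_lt hh hd hne)
  positivity

/-- The conformal-map form of the Green function. -/
theorem stripGreen_eq_log_div {z : ℝ} (hh : 0 < h) (hz₀ : -h < z₀ ∧ z₀ < 0) (hz : -h ≤ z)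
    (hz' : z ≤ 0) {x : ℝ} (hne : (x, z) ≠ (x₀, z₀)) :
    stripGreen h x₀ z₀ x z = 1 / (4 * Real.pi) * Real.log
      ((Real.cosh (Real.pi / h * (x - x₀)) - Real.cos (Real.pi / h * (z - z₀))) /
        (Real.cosh (Real.pi / h * (x - x₀)) - Real.cos (Real.pi / h * (z + z₀)))) := by
  have hs := abs_add_lt_two_mul hz₀ hz hz'
  have hd := abs_sub_lt_two_mul hz₀ hz hz'
  have hne' : x - x₀ ≠ 0 ∨ z - z₀ ≠ 0 := by
    by_contra! hcon
    exact hne (Prod.ext (sub_eq_zero.1 hcon.1) (sub_eq_zero.1 hcon.2))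
  have hs' : x - x₀ ≠ 0 ∨ z + z₀ ≠ 0 := Or.inr (by linarith [hz₀.2])
  have hq : (⟨x - x₀, z - z₀⟩ : ℂ) ≠ 0 := by
    intro h0
    rw [Complex.ext_iff] at h0
    exact hne'.elim (fun hX => hX h0.1) fun hd => hd h0.2
  have n1 := sinh_ne_zero_of_abs_lt hh hd hne'
  have n2 := sinh_ne_zero_of_abs_lt hh hs hs'
  rw [stripGreen_eq hh hz₀ hz hz', Real.log_div (cosh_sub_cos_pos hh hd hne').ne'
    (cosh_sub_cos_pos hh hs hs').ne', cosh_sub_cos_eq hh, cosh_sub_cos_eq hh,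
    Real.log_mul two_ne_zero (pow_ne_zero 2 (norm_ne_zero_iff.2 n1)),
    Real.log_mul two_ne_zero (pow_ne_zero 2 (norm_ne_zero_iff.2 n2)), Real.log_pow, Real.log_pow]
  have e1 : (⟨x, z⟩ : ℂ) - ⟨x₀, z₀⟩ = ⟨x - x₀, z - z₀⟩ := rfl
  have e2 : (⟨x, z⟩ : ℂ) - (starRingEnd ℂ) ⟨x₀, z₀⟩ = ⟨x - x₀, z + z₀⟩ := by
    apply Complex.ext <;> simp
  rw [stripCorrection, e1, e2, dslope_sinh_mul_of_ne _ hq, norm_div,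
    Real.log_div (norm_ne_zero_iff.2 n1) (norm_ne_zero_iff.2 hq), log_sq_add_sq_eq]
  push_cast
  ring

theorem harmonicAt_stripCorrection (hh : 0 < h) (hz₀ : -h < z₀ ∧ z₀ < 0) {p : ℂ}
    (hp : -h ≤ p.im) (hp' : p.im ≤ 0) :
    InnerProductSpace.HarmonicAt (stripCorrection h ⟨x₀, z₀⟩) p := by
  have hk : 0 < Real.pi / (2 * h) := by have := Real.pi_pos; positivity
  have e2 : p - (starRingEnd ℂ) (⟨x₀, z₀⟩ : ℂ) = ⟨p.re - x₀, p.im + z₀⟩ := by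
    apply Complex.ext <;> simp
  have a1 : AnalyticAt ℂ (fun p : ℂ =>
      Complex.sinh ((Real.pi / (2 * h) : ℝ) * (p - (starRingEnd ℂ) (⟨x₀, z₀⟩ : ℂ)))) p :=
    Differentiable.analyticAt (by fun_prop) p
  have a2 : AnalyticAt ℂ (fun p : ℂ =>
      dslope (fun w : ℂ => Complex.sinh ((Real.pi / (2 * h) : ℝ) * w)) 0 (p - ⟨x₀, z₀⟩)) p :=
    Differentiable.analyticAt
      ((differentiable_dslope_sinh_mul _).comp (differentiable_id.sub_const _)) p
  have h1 := a1.harmonicAt_log_norm (by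
    rw [e2]
    exact sinh_ne_zero_of_abs_lt hh (abs_add_lt_two_mul hz₀ hp hp') (Or.inr (by linarith [hz₀.2])))
  have h2 := a2.harmonicAt_log_norm (by
    refine dslope_sinh_mul_ne_zero hk ?_
    rw [div_div_eq_mul_div, mul_div_cancel_left₀ _ Real.pi_ne_zero]
    exact abs_sub_lt_two_mul hz₀ hp hp')
  exact (h1.const_smul (c := (2 : ℝ))).sub (h2.const_smul (c := (2 : ℝ)))

theorem isOpen_strip : IsOpen (strip h) :=
  (isOpen_lt continuous_const Complex.continuous_im).inter
    (isOpen_lt Complex.continuous_im continuous_const)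

theorem closure_strip_subset : closure (strip h) ⊆ {p : ℂ | -h ≤ p.im ∧ p.im ≤ 0} :=
  closure_minimal (fun _ hp => ⟨hp.1.le, hp.2.le⟩)
    ((isClosed_le continuous_const Complex.continuous_im).inter
      (isClosed_le Complex.continuous_im continuous_const))

theorem im_eq_of_mem_frontier_strip {p : ℂ} (hp : p ∈ frontier (strip h)) :
    p.im = 0 ∨ p.im = -h := by
  rw [isOpen_strip.frontier_eq] at hp
  have h1 := closure_strip_subset hp.1
  by_contra! hcon
  exact hp.2 ⟨lt_of_le_of_ne h1.1 hcon.2.symm, lt_of_le_of_ne h1.2 hcon.1⟩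

theorem freeGreen_sub_stripGreen {p : ℂ} (hh : 0 < h) (hz₀ : -h < z₀ ∧ z₀ < 0)
    (hp : -h ≤ p.im) (hp' : p.im ≤ 0) :
    freeGreen x₀ z₀ p.re p.im - stripGreen h x₀ z₀ p.re p.im =
      1 / (4 * Real.pi) * stripCorrection h ⟨x₀, z₀⟩ p := by
  rw [freeGreen, stripGreen_eq hh hz₀ hp hp']
  ring

theorem stripGreen_eq_log_norm {p : ℂ} (hh : 0 < h) (hz₀ : -h < z₀ ∧ z₀ < 0)
    (hp : -h ≤ p.im) (hp' : p.im ≤ 0) :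
    stripGreen h x₀ z₀ p.re p.im = 1 / (4 * Real.pi) *
      (Real.log (‖p - ⟨x₀, z₀⟩‖ ^ 2) - stripCorrection h ⟨x₀, z₀⟩ p) := by
  rw [stripGreen_eq hh hz₀ hp hp', log_sq_add_sq_eq, Real.log_pow]
  rfl

theorem continuousOn_stripCorrection (hh : 0 < h) (hz₀ : -h < z₀ ∧ z₀ < 0) :
    ContinuousOn (stripCorrection h ⟨x₀, z₀⟩) (closure (strip h)) := fun _ hp =>
  (harmonicAt_stripCorrection hh hz₀ (closure_strip_subset hp).1
    (closure_strip_subset hp).2).1.continuousAt.continuousWithinAt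

theorem isDirichletGreenFunction_stripGreen (hh : 0 < h) (hz₀ : -h < z₀ ∧ z₀ < 0) :
    IsDirichletGreenFunction (strip h) ⟨x₀, z₀⟩ (fun p : ℂ => stripGreen h x₀ z₀ p.re p.im) := by
  have hlog := locallyIntegrable_log_norm_sq (⟨x₀, z₀⟩ : ℂ)
  have hcorr := continuousOn_stripCorrection (x₀ := x₀) hh hz₀
  have heq : ∀ p ∈ closure (strip h), stripGreen h x₀ z₀ p.re p.im = 1 / (4 * Real.pi) *
      (Real.log (‖p - ⟨x₀, z₀⟩‖ ^ 2) - stripCorrection h ⟨x₀, z₀⟩ p) := fun p hp =>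
    stripGreen_eq_log_norm hh hz₀ (closure_strip_subset hp).1 (closure_strip_subset hp).2
  refine ⟨?_, ?_, ?_, ?_⟩
  · have h1 : LocallyIntegrableOn (fun p : ℂ => 1 / (4 * Real.pi) *
        (Real.log (‖p - ⟨x₀, z₀⟩‖ ^ 2) - stripCorrection h ⟨x₀, z₀⟩ p)) (strip h) := by
      have h2 : LocallyIntegrableOn (stripCorrection h ⟨x₀, z₀⟩) (strip h) :=
        (hcorr.mono subset_closure).locallyIntegrableOn isOpen_strip.measurableSet
      intro p hp
      obtain ⟨s, hs, hint⟩ := (hlog.locallyIntegrableOn (strip h) p hp).sub (h2 p hp)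
      exact ⟨s, hs, hint.const_mul _⟩
    intro p hp
    obtain ⟨s, hs, hint⟩ := h1 p hp
    refine ⟨s ∩ strip h, inter_mem hs self_mem_nhdsWithin,
      (hint.mono_set inter_subset_left).congr ?_⟩
    have hm : ∀ᵐ q ∂(volume.restrict (s ∩ strip h)), q ∈ strip h := by
      refine ae_restrict_of_ae_restrict_of_subset inter_subset_right
        (ae_restrict_mem isOpen_strip.measurableSet)
    filter_upwards [hm] with q hq
    exact (heq q (subset_closure hq)).symm
  · intro φ hφ hc hs
    have hΔc := continuous_laplacian hφ hc
    have hΔs := hasCompactSupport_laplacian hc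
    have hharm : InnerProductSpace.HarmonicOnNhd (stripCorrection h ⟨x₀, z₀⟩) (strip h) :=
      fun p hp => harmonicAt_stripCorrection hh hz₀ hp.1.le hp.2.le
    have h1 := integral_log_norm_sq_mul_laplacian hφ hc (⟨x₀, z₀⟩ : ℂ)
    have h2 := integral_mul_laplacian_eq_zero_of_harmonicOnNhd isOpen_strip hharm hφ hc hs
    have i1 : Integrable (fun p : ℂ => Real.log (‖p - ⟨x₀, z₀⟩‖ ^ 2) *
        Laplacian.laplacian φ p) := by
      simpa only [smul_eq_mul] using
        hlog.integrable_smul_right_of_hasCompactSupport hΔc hΔs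
    have i2 : Integrable (fun p : ℂ => stripCorrection h ⟨x₀, z₀⟩ p *
        Laplacian.laplacian φ p) := by
      have h3 : IntegrableOn (fun p : ℂ => stripCorrection h ⟨x₀, z₀⟩ p *
          Laplacian.laplacian φ p) (tsupport φ) :=
        ((hcorr.mono (hs.trans subset_closure)).mul hΔc.continuousOn).integrableOn_compact hc
      refine (integrableOn_iff_integrable_of_support_subset ?_).1 h3
      intro p hp
      by_contra hcon
      exact hp (by simp [laplacian_eq_zero_of_notMem_tsupport hcon])
    calc ∫ p : ℂ, stripGreen h x₀ z₀ p.re p.im * Laplacian.laplacian φ p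
        = ∫ p : ℂ, 1 / (4 * Real.pi) * (Real.log (‖p - ⟨x₀, z₀⟩‖ ^ 2) *
            Laplacian.laplacian φ p - stripCorrection h ⟨x₀, z₀⟩ p *
            Laplacian.laplacian φ p) := by
          refine integral_congr_ae (Eventually.of_forall fun p => ?_)
          by_cases hp : p ∈ tsupport φ
          · simp only
            rw [heq p (subset_closure (hs hp))]
            ring
          · simp [laplacian_eq_zero_of_notMem_tsupport hp]
      _ = φ ⟨x₀, z₀⟩ := by
          rw [integral_const_mul, integral_sub i1 i2, h1, h2]
          have := Real.pi_ne_zero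
          field_simp
          ring
  · refine ContinuousOn.congr (f := fun p : ℂ => 1 / (4 * Real.pi) *
      (Real.log (‖p - ⟨x₀, z₀⟩‖ ^ 2) - stripCorrection h ⟨x₀, z₀⟩ p)) ?_ fun p hp => heq p hp.1
    refine continuousOn_const.mul (ContinuousOn.sub ?_ (hcorr.mono sdiff_subset))
    refine ContinuousOn.log (by fun_prop) fun p hp => ?_
    have := norm_pos_iff.2 (sub_ne_zero.2 hp.2)
    positivity
  · intro p hp
    have hp1 := closure_strip_subset (frontier_subset_closure hp)
    have hedge := im_eq_of_mem_frontier_strip hp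
    have hne : (p.re, p.im) ≠ (x₀, z₀) := by
      intro h0
      have : p.im = z₀ := congrArg Prod.snd h0
      rcases hedge with h1 | h1 <;> linarith [hz₀.1, hz₀.2]
    -- The two arguments add up to `0` on `z = 0` and to `-2 π` on `z = -h`.
    have hcos : Real.cos (Real.pi / h * (p.im - z₀)) = Real.cos (Real.pi / h * (p.im + z₀)) := by
      rcases hedge with h1 | h1
      · rw [h1, ← Real.cos_neg]; congr 1; ring
      · rw [h1, ← Real.cos_neg, ← Real.cos_sub_two_pi]
        congr 1
        field_simp
        ring
    rw [stripGreen_eq_log_div hh hz₀ hp1.1 hp1.2 hne, hcos, div_self, Real.log_one, mul_zero]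
    exact (cosh_sub_cos_pos hh (abs_add_lt_two_mul hz₀ hp1.1 hp1.2)
      (Or.inr (by linarith [hz₀.2, hp1.2]))).ne'

theorem tendsto_stripGreen_cobounded (hh : 0 < h) (hz₀ : -h < z₀ ∧ z₀ < 0) :
    Tendsto (fun p : ℂ => stripGreen h x₀ z₀ p.re p.im)
      (Bornology.cobounded ℂ ⊓ 𝓟 (closure (strip h))) (𝓝 0) := by
  set l := Bornology.cobounded ℂ ⊓ 𝓟 (closure (strip h)) with hl
  have hmem : ∀ᶠ p in l, p ∈ closure (strip h) := mem_inf_of_right (mem_principal_self _)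
  have hnorm : Tendsto (fun p : ℂ => ‖p‖) l atTop :=
    tendsto_norm_cobounded_atTop.mono_left inf_le_left
  -- In the strip `|im p| ≤ h`, so `p` can only escape to infinity horizontally.
  have habs : Tendsto (fun p : ℂ => |p.re - x₀|) l atTop := by
    refine tendsto_atTop_mono' l ?_ (tendsto_atTop_add_const_right l (-(h + |x₀|)) hnorm)
    filter_upwards [hmem] with p hp
    have h1 := closure_strip_subset hp
    have h2 := Complex.norm_le_abs_re_add_abs_im p
    have h3 : |p.im| ≤ h := by rw [abs_le]; constructor <;> linarith [h1.1, h1.2]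
    linarith [abs_sub_abs_le_abs_sub p.re x₀]
  have hexp : Tendsto (fun p : ℂ => Real.cosh (Real.pi / h * (p.re - x₀))) l atTop := by
    refine tendsto_atTop_mono (f := fun p : ℂ => Real.pi / h * |p.re - x₀| / 2) ?_ ?_
    · intro p
      rw [← Real.cosh_abs, abs_mul, abs_of_pos (div_pos Real.pi_pos hh), Real.cosh_eq]
      have := Real.add_one_le_exp (Real.pi / h * |p.re - x₀|)
      have := Real.exp_pos (-(Real.pi / h * |p.re - x₀|))
      linarith
    · exact (habs.const_mul_atTop (div_pos Real.pi_pos hh)).atTop_div_const two_pos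
  have hratio : Tendsto (fun p : ℂ =>
      (Real.cosh (Real.pi / h * (p.re - x₀)) - Real.cos (Real.pi / h * (p.im - z₀))) /
        (Real.cosh (Real.pi / h * (p.re - x₀)) - Real.cos (Real.pi / h * (p.im + z₀)))) l
      (𝓝 1) := by
    have hden : Tendsto (fun p : ℂ => Real.cosh (Real.pi / h * (p.re - x₀)) - 1) l atTop :=
      tendsto_atTop_add_const_right l (-1) hexp
    -- The quotient minus `1`; its numerator is at most `2` in absolute value.
    have hsmall : Tendsto (fun p : ℂ =>
        (Real.cos (Real.pi / h * (p.im + z₀)) - Real.cos (Real.pi / h * (p.im - z₀))) /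
        (Real.cosh (Real.pi / h * (p.re - x₀)) - Real.cos (Real.pi / h * (p.im + z₀)))) l
        (𝓝 0) := by
      refine squeeze_zero_norm' ?_ (hden.const_div_atTop 2)
      filter_upwards [hden.eventually_gt_atTop 0] with p hp
      rw [norm_div, Real.norm_eq_abs, Real.norm_eq_abs]
      have c1 := Real.abs_cos_le_one (Real.pi / h * (p.im + z₀))
      have c2 := Real.abs_cos_le_one (Real.pi / h * (p.im - z₀))
      have c3 := Real.cos_le_one (Real.pi / h * (p.im + z₀))
      refine div_le_div₀ two_pos.le ((abs_sub _ _).trans (by linarith)) hp ?_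
      exact (by linarith : _ ≤ Real.cosh (Real.pi / h * (p.re - x₀)) -
        Real.cos (Real.pi / h * (p.im + z₀))).trans (le_abs_self _)
    have h1 := hsmall.const_add 1
    rw [add_zero] at h1
    refine h1.congr' ?_
    filter_upwards [hden.eventually_gt_atTop 0] with p hp
    have c3 := Real.cos_le_one (Real.pi / h * (p.im + z₀))
    have : Real.cosh (Real.pi / h * (p.re - x₀)) - Real.cos (Real.pi / h * (p.im + z₀)) ≠ 0 := by
      linarith
    rw [eq_div_iff this, add_mul, div_mul_cancel₀ _ this]
    ring
  have hfin := (hratio.log one_ne_zero).const_mul (1 / (4 * Real.pi))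
  rw [Real.log_one, mul_zero] at hfin
  refine hfin.congr' ?_
  filter_upwards [hmem, habs.eventually_gt_atTop 0] with p hp hp0
  have h1 := closure_strip_subset hp
  rw [stripGreen_eq_log_div hh hz₀ h1.1 h1.2]
  intro h0
  have : p.re = x₀ := congrArg Prod.fst h0
  rw [this] at hp0
  simp at hp0

end

theorem mainTheorem3 (h x₀ z₀ : ℝ) (hh : 0 < h) (hz₀ : -h < z₀ ∧ z₀ < 0) :
    -- the two multiplier terms are well defined, as continuous functions of `x`
    (∀ z : ℝ, -h ≤ z → z ≤ 0 →
      (∃! u : ℝ → ℝ, IsMultiplierImage (sinhRatio (z + h) h)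
        (fun y : ℝ => Real.log ((y - x₀) ^ 2 + z₀ ^ 2)) u) ∧
      (∃! u : ℝ → ℝ, IsMultiplierImage (sinhRatio z h)
        (fun y : ℝ => Real.log ((y - x₀) ^ 2 + (h + z₀) ^ 2)) u)) ∧
    -- the representation is the Dirichlet Green function of the strip, decaying at infinity
    IsDirichletGreenFunction (strip h) ⟨x₀, z₀⟩
      (fun p : ℂ => stripGreen h x₀ z₀ p.re p.im) ∧
    Tendsto (fun p : ℂ => stripGreen h x₀ z₀ p.re p.im)
      (Bornology.cobounded ℂ ⊓ 𝓟 (closure (strip h))) (𝓝 0) ∧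
    -- the correction of the free-space logarithm is harmonic in the strip,
    -- and continuous up to the boundary
    InnerProductSpace.HarmonicOnNhd
      (fun p : ℂ => freeGreen x₀ z₀ p.re p.im - stripGreen h x₀ z₀ p.re p.im) (strip h) ∧
    ContinuousOn
      (fun p : ℂ => freeGreen x₀ z₀ p.re p.im - stripGreen h x₀ z₀ p.re p.im)
      (closure (strip h)) ∧
    -- it agrees with the conformal-map form and with the image form
    (∀ x z : ℝ, -h ≤ z → z ≤ 0 → (x, z) ≠ (x₀, z₀) →
      stripGreen h x₀ z₀ x z =
        1 / (4 * Real.pi) * Real.log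
          ((Real.cosh (Real.pi / h * (x - x₀)) - Real.cos (Real.pi / h * (z - z₀))) /
            (Real.cosh (Real.pi / h * (x - x₀)) - Real.cos (Real.pi / h * (z + z₀)))) ∧
      Tendsto (fun N : ℕ => 1 / (4 * Real.pi) * Real.log
          (∏ n ∈ Finset.Icc (-(N : ℤ)) (N : ℤ),
            ((x - x₀) ^ 2 + (z - z₀ - 2 * (n : ℝ) * h) ^ 2) /
              ((x - x₀) ^ 2 + (z + z₀ + 2 * (n : ℝ) * h) ^ 2)))
        atTop (𝓝 (stripGreen h x₀ z₀ x z))) := by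
  refine ⟨fun z hz hz' => ⟨?_, ?_⟩, isDirichletGreenFunction_stripGreen hh hz₀,
    tendsto_stripGreen_cobounded hh hz₀, ?_, ?_, fun x z hz hz' hne =>
      ⟨stripGreen_eq_log_div hh hz₀ hz hz' hne, tendsto_stripGreen hh hz₀ hz hz' hne⟩⟩
  · exact ⟨_, isMultiplierImage_top hh hz₀ hz hz', fun v hv =>
      hv.unique (isMultiplierImage_top hh hz₀ hz hz')⟩
  · exact ⟨_, isMultiplierImage_bottom hh hz₀ hz hz', fun v hv =>
      hv.unique (isMultiplierImage_bottom hh hz₀ hz hz')⟩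
  · intro p hp
    refine (InnerProductSpace.harmonicAt_congr_nhds ?_).2
      ((harmonicAt_stripCorrection (x₀ := x₀) hh hz₀ hp.1.le hp.2.le).const_smul
        (c := 1 / (4 * Real.pi)))
    filter_upwards [isOpen_strip.mem_nhds hp] with q hq
    exact freeGreen_sub_stripGreen hh hz₀ hq.1.le hq.2.le
  · refine ((continuousOn_stripCorrection (x₀ := x₀) hh hz₀).const_mul
      (1 / (4 * Real.pi))).congr fun p hp => ?_
    exact freeGreen_sub_stripGreen hh hz₀ (closure_strip_subset hp).1 (closure_strip_subset hp).2
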